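/- Let $\sigma:[0,1]\to[0,\infty)$ be a bounded measurable (deterministic) function, let $\varphi\in\mathbb R$ with $|\varphi|<1$, let $(W_i)_{i\in\mathbb Z}$ be independent standard Brownian motions, and let $(\varepsilon_i)_{i\in\mathbb Z}$ be i.i.d. random variables with mean zero and finite positive variance, such that the sequences $(W_i)$ and $(\varepsilon_i)$ are independent. A pair $(g,R)$ of a sequence $(g_i)_{i\in\mathbb Z}$ of a.s. positive random variables, independent of the sequence $(W_i)$, and a sequence $(R_i)_{i\in\mathbb Z}$ of random curves on $[0,1]$ is called a solution if, for all $i\in\mathbb Z$, almost surely, $$R_i(t)=g_i\int_0^t\sigma(u)\,dW_i(u)\quad (t\in[0,1]),\qquad \log g_i=\varphi\log g_{i-1}+\varepsilon_i ,$$ where the Itô integral is taken in its time-continuous version. Put $G(t)=\int_0^t\sigma^2(u)\,du$, and $H(t)=\log G(t)$ when $G(t)>0$. Then: 1. There is a solution $(g,R)$ such that both $(\log g_i)$ and $(R_i)$ are strictly stationary. It is unique: if $(g',R')$ is a solution and $(R'_i)$ is strictly stationary, then almost surely $R'_i(t)=R_i(t)$ for all $i\in\mathbb Z$, $t\in[0,1]$;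 and if $(g',R')$ is a solution and $(\log g'_i)$ is strictly stationary, then almost surely $g'_i=g_i$ and $R'_i(t)=R_i(t)$ for all $i$ and $t$. 2. For every solution $(g,R)$ with $(R_i)$ strictly stationary and every $i$, the quadratic variation process $Q_i(t)=\langle R_i,R_i\rangle_t$ (limit in probability of the sums of squared increments over partitions of $[0,t]$ with mesh tending to zero) exists and equals $g_i^2\,G(t)$. For every $t$ with $G(t)>0$, almost surely $\log Q_i(t)=2\log g_i+H(t)$; moreover $\log Q_i(t)$ is integrable and $$\mathbb E\log Q_i(t)=H(t)=\log\int_0^t\sigma^2(u)\,du .$$ 3. The scalar $g_i$ and the function $\sigma$ are identifiable from the curve $R_i$: let $(g,R)$ be a solution with $(R_i)$ strictly stationary, and let $(g',R')$ be such a solution of a second model of the same kind, with data $\sigma',\varphi',(\varepsilon'_i),(W'_i)$, possibly on another probability space. If for some $i$ the curves $R_i$ and $R'_i$ have the same law, then $\sigma=\sigma'$ Lebesgue-a.e. on $[0,1]$, and, if $G(1)>0$, the pairs $(g_i,R_i)$ and $(g'_i,R'_i)$ have the same law. -/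

import Mathlib

open MeasureTheory ProbabilityTheory Filter Topology
open scoped NNReal ENNReal

universe u v

namespace FunctionalSV

/-- A deterministic step function `∑_{k<n} c_k 1_{(t_k, t_{k+1}]}` on `[0, ∞)`. -/
structure StepFunction where
  n : ℕ
  time : ℕ → ℝ≥0
  time_mono : Monotone time
  coef : ℕ → ℝ

/-- The values of a step function. -/
noncomputable def StepFunction.toFun (f : StepFunction) (u : ℝ) : ℝ :=
  ∑ k ∈ Finset.range f.n,
    (Set.Ioc (f.time k : ℝ) (f.time (k + 1) : ℝ)).indicator (fun _ => f.coef k) u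

/-- The elementary stochastic integral `∫_0^t f dB = ∑ c_k (B_{t_{k+1} ∧ t} - B_{t_k ∧ t})`. -/
noncomputable def StepFunction.integral {Ω : Type u} (f : StepFunction) (B : ℝ≥0 → Ω → ℝ)
    (t : ℝ≥0) (ω : Ω) : ℝ :=
  ∑ k ∈ Finset.range f.n,
    f.coef k * (B (min (f.time (k + 1)) t) ω - B (min (f.time k) t) ω)

/-- `J` is (a continuous version of) the Itô integral process `t ↦ ∫_0^t σ dB`, `t ∈ [0,1]`,
of the deterministic function `σ`: there are step functions converging to `σ` in `L²([0,1])`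
whose elementary stochastic integrals up to time `t` converge to `J t` in `L²(P)`, for each
`t ∈ [0,1]`. -/
structure IsItoIntegral {Ω : Type u} [MeasurableSpace Ω] (σ : ℝ → ℝ) (B : ℝ≥0 → Ω → ℝ)
    (J : unitInterval → Ω → ℝ) (P : Measure Ω) : Prop where
  measurable : ∀ t, Measurable (J t)
  continuous : ∀ᵐ ω ∂P, Continuous (fun t => J t ω)
  limit : ∃ f : ℕ → StepFunction,
    Tendsto (fun n => eLpNorm (fun u => (f n).toFun u - σ u) 2
      (volume.restrict (Set.Icc (0 : ℝ) 1))) atTop (𝓝 0) ∧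
    ∀ t : unitInterval, Tendsto (fun n => eLpNorm
      (fun ω => (f n).integral B (unitInterval.toNNReal t) ω - J t ω) 2 P) atTop (𝓝 0)

/-- A two-sided sequence of random elements is strictly stationary if its law (on the sequence
space with the product `σ`-algebra) is invariant under all shifts of the index. For a sequence of
random curves, `S` is the space of functions on `[0,1]` with its cylinder `σ`-algebra. -/
def StrictlyStationary {Ω : Type u} [MeasurableSpace Ω] {S : Type v} [MeasurableSpace S]
    (X : ℤ → Ω → S) (P : Measure Ω) : Prop :=
  ∀ h : ℤ, IdentDistrib (fun ω i => X (i + h) ω) (fun ω i => X i ω) P P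

/-- `Q` is the quadratic variation process `t ↦ ⟨X, X⟩_t` of the process `X` on `[0,1]`: it starts
at zero, has continuous nondecreasing paths, and for every `t` and every sequence of partitions
`0 = τ n 0 ≤ τ n 1 ≤ … ≤ τ n (N n) = t` whose mesh tends to zero, the sums of the squared
increments of `X` along the partitions tend to `Q t` in probability. -/
structure IsQuadraticVariation {Ω : Type u} [MeasurableSpace Ω] (X Q : unitInterval → Ω → ℝ)
    (P : Measure Ω) : Prop where
  measurable : ∀ t, Measurable (Q t)
  zero : ∀ᵐ ω ∂P, Q 0 ω = 0
  continuous : ∀ᵐ ω ∂P, Continuous (fun t => Q t ω)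
  monotone : ∀ᵐ ω ∂P, Monotone (fun t => Q t ω)
  limit : ∀ (t : unitInterval) (N : ℕ → ℕ) (τ : ℕ → ℕ → unitInterval),
    (∀ n, Monotone (τ n)) → (∀ n, τ n 0 = 0) → (∀ n, τ n (N n) = t) →
    (∀ δ : ℝ, 0 < δ → ∀ᶠ n in atTop, ∀ k < N n, (τ n (k + 1) : ℝ) - (τ n k : ℝ) < δ) →
    TendstoInMeasure P
      (fun n ω => ∑ k ∈ Finset.range (N n), (X (τ n (k + 1)) ω - X (τ n k) ω) ^ 2)
      atTop (Q t)

/-- Cumulative volatility `G(t) = ∫_0^t σ²(u) du`. -/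
noncomputable def G (σ : ℝ → ℝ) (t : unitInterval) : ℝ := ∫ u in (0 : ℝ)..(t : ℝ), σ u ^ 2

/-- `H(t) = log ∫_0^t σ²(u) du`; meaningful when the integral is positive. -/
noncomputable def H (σ : ℝ → ℝ) (t : unitInterval) : ℝ := Real.log (G σ t)

/-- The conditions on the inputs of the model: the volatility function `σ` on `[0,1]`, the
autoregressive coefficient `φ`, the innovations `ε i` and the Brownian motions `W i`. -/
structure Conditions {Ω : Type u} [MeasurableSpace Ω] (σ : ℝ → ℝ) (φ : ℝ) (ε : ℤ → Ω → ℝ)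
    (W : ℤ → ℝ≥0 → Ω → ℝ) (P : Measure Ω) : Prop where
  sigma_measurable : Measurable σ
  sigma_nonneg : ∀ t ∈ Set.Icc (0 : ℝ) 1, 0 ≤ σ t
  sigma_bounded : ∃ C : ℝ, ∀ t ∈ Set.Icc (0 : ℝ) 1, σ t ≤ C
  W_measurable : ∀ i t, Measurable (W i t)
  W_brownian : ∀ i, IsBrownianReal (W i) P
  W_indep : iIndepFun (fun i ω t => W i t ω) P
  eps_measurable : ∀ i, Measurable (ε i)
  eps_indep : iIndepFun ε P
  eps_identDistrib : ∀ i j, IdentDistrib (ε i) (ε j) P P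
  eps_memLp : ∀ i, MemLp (ε i) 2 P
  eps_mean : ∀ i, ∫ ω, ε i ω ∂P = 0
  eps_variance : ∀ i, 0 < variance (ε i) P
  W_indep_eps : IndepFun (fun ω i t => W i t ω) (fun ω i => ε i ω) P
  phi_lt_one : |φ| < 1

/-- The pair `(g, R)` satisfies the model equations
`R_i(t) = g_i ∫_0^t σ dW_i`, `t ∈ [0,1]`, and `log g_i = φ log g_{i-1} + ε_i`, `i ∈ ℤ`,
where the `g_i` are positive with probability one and `{g_i}` is independent of `{W_i}`. -/
structure IsSolution {Ω : Type u} [MeasurableSpace Ω] (σ : ℝ → ℝ) (φ : ℝ) (ε : ℤ → Ω → ℝ)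
    (W : ℤ → ℝ≥0 → Ω → ℝ) (g : ℤ → Ω → ℝ) (R : ℤ → unitInterval → Ω → ℝ) (P : Measure Ω) : Prop where
  g_measurable : ∀ i, Measurable (g i)
  g_pos : ∀ i, ∀ᵐ ω ∂P, 0 < g i ω
  g_indep : IndepFun (fun ω i t => W i t ω) (fun ω i => g i ω) P
  ar : ∀ i, ∀ᵐ ω ∂P, Real.log (g i ω) = φ * Real.log (g (i - 1) ω) + ε i ω
  R_measurable : ∀ i t, Measurable (R i t)
  R_eq : ∀ i, ∃ J : unitInterval → Ω → ℝ, IsItoIntegral σ (W i) J P ∧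
    ∀ᵐ ω ∂P, ∀ t, R i t ω = g i ω * J t ω

end FunctionalSV

/-! For deterministic `σ`, the Itô integral is an `L²` limit of linear combinations of Brownian
values. It is therefore a centred Gaussian process with covariance `G σ (min s t)`, and its disjoint
increments are independent. Sums of squared increments over a partition of `[0,t]` have mean exactly
`G σ t` and variance at most a constant times the mesh, so they tend to `G σ t` in probability
(`IsWienerIntegral.tendstoInMeasure_sum_sq_increments`). Multiplying by the random constant `g i ^
2` gives the quadratic variation of a curve.

That quadratic variation is a measurable functional `Ψ` of the curve, the same for all curves with
the same law (`exists_functional_of_tendstoInMeasure`). Hence stationarity of the curves passes to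
`log g`. Since `|φ| < 1`, the AR(1) equation has only one solution with constant marginals, the
moving average `∑ φ ^ j ε_{i-j}` (`ar_unique`). This gives uniqueness and `𝔼 log g = 0`, so `𝔼 log Q
= H`. If `G σ` vanishes identically, the curves say nothing about `g` but are themselves zero.

For existence, take the exponential of the moving average and a continuous version of the integral
(`exists_isItoIntegral`, by dyadic chaining). The curves are stationary because each is the same
functional of `(W_i, g_i)`.

For identifiability, equal laws of the curves give equal laws of `Ψ`. Taking the mean of `log Ψ`
removes `g` and yields `G σ = G σ'`, hence `σ = σ'` a.e.; then `g = √(Ψ / G)` is a common functional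
of the curve. -/

namespace FunctionalSV

/-! ### Convergence of second moments in `L²`. -/

section SecondMoments

variable {α : Type*} [MeasurableSpace α] {μ : Measure α}

lemma eLpNorm_two_eq_zero_of_integral_sq {f : α → ℝ} (hf : MemLp f 2 μ)
    (h : ∫ x, f x ^ 2 ∂μ = 0) : f =ᵐ[μ] 0 := by
  have := (integral_eq_zero_iff_of_nonneg (fun x => sq_nonneg (f x)) hf.integrable_sq).1 h
  filter_upwards [this] with x hx
  simpa using hx

lemma memLp_of_tendsto_eLpNorm_sub {X : ℕ → α → ℝ} {Y : α → ℝ} (hX : ∀ n, MemLp (X n) 2 μ)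
    (hY : AEStronglyMeasurable Y μ)
    (h : Tendsto (fun n => eLpNorm (fun x => X n x - Y x) 2 μ) atTop (𝓝 0)) : MemLp Y 2 μ := by
  obtain ⟨n, hn⟩ := (h.eventually (gt_mem_nhds ENNReal.zero_lt_top)).exists
  have h1 : MemLp (fun x => X n x - Y x) 2 μ := ⟨(hX n).1.sub hY, hn⟩
  have h2 := (hX n).sub h1
  refine h2.ae_eq (Eventually.of_forall fun x => ?_)
  simp

/-- Continuity of the `L²` inner product; this carries the isometry from step functions to their
limits. -/
lemma tendsto_integral_mul {X Y : ℕ → α → ℝ} {X' Y' : α → ℝ} (hX : ∀ n, MemLp (X n) 2 μ)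
    (hY : ∀ n, MemLp (Y n) 2 μ) (hX' : MemLp X' 2 μ) (hY' : MemLp Y' 2 μ)
    (h : Tendsto (fun n => eLpNorm (fun x => X n x - X' x) 2 μ) atTop (𝓝 0))
    (h' : Tendsto (fun n => eLpNorm (fun x => Y n x - Y' x) 2 μ) atTop (𝓝 0)) :
    Tendsto (fun n => ∫ x, X n x * Y n x ∂μ) atTop (𝓝 (∫ x, X' x * Y' x ∂μ)) := by
  have key : ∀ (U V : α → ℝ) (hU : MemLp U 2 μ) (hV : MemLp V 2 μ),
      ∫ x, U x * V x ∂μ = inner ℝ (hU.toLp U) (hV.toLp V) := by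
    intro U V hU hV
    rw [L2.inner_def]
    refine integral_congr_ae ?_
    filter_upwards [hU.coeFn_toLp, hV.coeFn_toLp] with x h1 h2
    simp [h1, h2, mul_comm]
  have t1 := (Lp.tendsto_Lp_iff_tendsto_eLpNorm'' X hX X' hX').2 h
  have t2 := (Lp.tendsto_Lp_iff_tendsto_eLpNorm'' Y hY Y' hY').2 h'
  rw [key X' Y' hX' hY']
  simp_rw [fun n => key _ _ (hX n) (hY n)]
  exact t1.inner t2

lemma integral_sub_mul_sub {X Y U V : α → ℝ} (hX : MemLp X 2 μ) (hY : MemLp Y 2 μ)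
    (hU : MemLp U 2 μ) (hV : MemLp V 2 μ) :
    ∫ x, (X x - Y x) * (U x - V x) ∂μ =
      ∫ x, X x * U x ∂μ - ∫ x, X x * V x ∂μ - ∫ x, Y x * U x ∂μ + ∫ x, Y x * V x ∂μ := by
  have i1 : Integrable (fun x => X x * U x) μ := hX.integrable_mul hU
  have i2 : Integrable (fun x => X x * V x) μ := hX.integrable_mul hV
  have i3 : Integrable (fun x => Y x * U x) μ := hY.integrable_mul hU
  have i4 : Integrable (fun x => Y x * V x) μ := hY.integrable_mul hV
  have i5 : Integrable (fun x => X x * U x - X x * V x) μ := i1.sub i2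
  have i6 : Integrable (fun x => X x * U x - X x * V x - Y x * U x) μ := i5.sub i3
  rw [← integral_sub i1 i2, ← integral_sub i5 i3, ← integral_add i6 i4]
  exact integral_congr_ae (Eventually.of_forall fun x => by ring)

end SecondMoments

/-! ### Elementary integrals of step functions against Brownian motion. -/

variable {Ω : Type u} [MeasurableSpace Ω] {P : Measure Ω}

lemma StepFunction.memLp_toFun (f : StepFunction) (μ : Measure ℝ) [IsFiniteMeasure μ] :
    MemLp f.toFun 2 μ := by
  unfold StepFunction.toFun
  exact memLp_finsetSum _ fun k _ => (memLp_const _).indicator measurableSet_Ioc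

lemma StepFunction.measurable_integral (f : StepFunction) {B : ℝ≥0 → Ω → ℝ}
    (hB : ∀ t, Measurable (B t)) (t : ℝ≥0) : Measurable (f.integral B t) := by
  unfold StepFunction.integral
  exact Finset.measurable_sum _ fun k _ => ((hB _).sub (hB _)).const_mul _

lemma StepFunction.memLp_integral (f : StepFunction) {B : ℝ≥0 → Ω → ℝ}
    (hB : IsPreBrownianReal B P) (t : ℝ≥0) : MemLp (f.integral B t) 2 P := by
  unfold StepFunction.integral
  exact memLp_finsetSum _ fun k _ =>
    ((hB.isGaussianProcess.hasGaussianLaw_eval _).memLp_two.sub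
      (hB.isGaussianProcess.hasGaussianLaw_eval _).memLp_two).const_mul _

lemma StepFunction.integral_integral (f : StepFunction) {B : ℝ≥0 → Ω → ℝ}
    (hB : IsPreBrownianReal B P) (t : ℝ≥0) : ∫ ω, f.integral B t ω ∂P = 0 := by
  unfold StepFunction.integral
  have i : ∀ a b, Integrable (fun ω => B a ω - B b ω) P :=
    fun a b => (hB.integrable_eval a).sub (hB.integrable_eval b)
  rw [integral_finsetSum _ fun k _ => (i _ _).const_mul _]
  refine Finset.sum_eq_zero fun k _ => ?_
  rw [integral_const_mul, integral_sub (hB.integrable_eval _) (hB.integrable_eval _),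
    hB.integral_eval, hB.integral_eval, sub_zero, mul_zero]

/-- The value at each time is a linear function of finitely many Brownian values. -/
lemma StepFunction.isGaussianProcess_integral (f : StepFunction) {B : ℝ≥0 → Ω → ℝ}
    (hB : IsPreBrownianReal B P) : IsGaussianProcess (f.integral B) P := by
  classical
  refine hB.isGaussianProcess.of_isGaussianProcess fun t => ?_
  refine ⟨(Finset.range (f.n + 1)).image (fun k => min (f.time k) t), ∑ k : Fin f.n,
    f.coef k • (ContinuousLinearMap.proj (R := ℝ) (φ := fun _ => ℝ)
        ⟨min (f.time (k + 1)) t, Finset.mem_image.2 ⟨k + 1, by simp, rfl⟩⟩ -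
      ContinuousLinearMap.proj (R := ℝ) (φ := fun _ => ℝ)
        ⟨min (f.time k) t, Finset.mem_image.2 ⟨k, by simp, rfl⟩⟩), fun ω => ?_⟩
  simp [StepFunction.integral, Finset.sum_range]

/-- The right side is the covariance of two Brownian increments expanded by bilinearity, each
covariance being a minimum of times. -/
lemma Ioc_inter_overlap {a b c d : ℝ} (hab : a ≤ b) (hcd : c ≤ d) :
    volume.real (Set.Ioc a b ∩ Set.Ioc c d) = min b d - min b c - min a d + min a c := by
  rw [Set.Ioc_inter_Ioc, Real.volume_real_Ioc]
  grind

lemma integral_brownian_incr_mul {B : ℝ≥0 → Ω → ℝ} (hB : IsPreBrownianReal B P) (a b c d : ℝ≥0)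
    (hab : a ≤ b) (hcd : c ≤ d) :
    ∫ ω, (B b ω - B a ω) * (B d ω - B c ω) ∂P =
      volume.real (Set.Ioc (a : ℝ) b ∩ Set.Ioc (c : ℝ) d) := by
  have m := fun t => (hB.isGaussianProcess.hasGaussianLaw_eval t).memLp_two
  have := hB.isGaussianProcess.isProbabilityMeasure
  have e : ∀ s t, ∫ ω, B s ω * B t ω ∂P = min (s : ℝ) t := by
    intro s t
    have := hB.covariance_eval s t
    rw [covariance_eq_sub (m s) (m t), hB.integral_eval, hB.integral_eval] at this
    simpa using this
  rw [Ioc_inter_overlap (by exact_mod_cast hab) (by exact_mod_cast hcd),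
    FunctionalSV.integral_sub_mul_sub (m _) (m _) (m _) (m _), e, e, e, e]

/-- The Itô isometry for step functions, in polarized form. -/
lemma StepFunction.integral_mul_integral (f g : StepFunction) {B : ℝ≥0 → Ω → ℝ}
    (hB : IsPreBrownianReal B P) (s t : ℝ≥0) :
    ∫ ω, f.integral B s ω * g.integral B t ω ∂P =
      ∫ u in Set.Ioc (0 : ℝ) (min s t : ℝ≥0), f.toFun u * g.toFun u := by
  have m : ∀ a b, MemLp (fun ω => B b ω - B a ω) 2 P := fun a b =>
    ((hB.isGaussianProcess.hasGaussianLaw_eval _).memLp_two.sub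
      (hB.isGaussianProcess.hasGaussianLaw_eval _).memLp_two)
  have step : ∀ k l, ∫ ω, (B (min (f.time (k + 1)) s) ω - B (min (f.time k) s) ω) *
      (B (min (g.time (l + 1)) t) ω - B (min (g.time l) t) ω) ∂P =
      ∫ u in Set.Ioc (0 : ℝ) (min s t : ℝ≥0),
        (Set.Ioc (f.time k : ℝ) (f.time (k + 1))).indicator (fun _ => (1 : ℝ)) u *
          (Set.Ioc (g.time l : ℝ) (g.time (l + 1))).indicator (fun _ => (1 : ℝ)) u := by
    intro k l
    have hf := f.time_mono (Nat.le_succ k)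
    have hg := g.time_mono (Nat.le_succ l)
    rw [integral_brownian_incr_mul hB _ _ _ _ (min_le_min_right _ hf) (min_le_min_right _ hg)]
    have : ∀ u, (Set.Ioc (f.time k : ℝ) (f.time (k + 1))).indicator (fun _ => (1 : ℝ)) u *
          (Set.Ioc (g.time l : ℝ) (g.time (l + 1))).indicator (fun _ => (1 : ℝ)) u =
        (Set.Ioc (f.time k : ℝ) (f.time (k + 1)) ∩
          Set.Ioc (g.time l : ℝ) (g.time (l + 1))).indicator (fun _ => (1 : ℝ)) u := by
      intro u
      simp only [Set.indicator_apply, Set.mem_inter_iff]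
      split_ifs <;> simp_all
    simp_rw [this]
    rw [integral_indicator (measurableSet_Ioc.inter measurableSet_Ioc), setIntegral_const,
      smul_eq_mul, mul_one, measureReal_restrict_apply (measurableSet_Ioc.inter measurableSet_Ioc)]
    -- Stopping the two integrals at `s` and `t` amounts to cutting the overlap of the intervals
    -- down to `(0, min s t]`.
    congr 1
    ext u
    have h1 := (f.time k).coe_nonneg
    simp only [Set.mem_inter_iff, Set.mem_Ioc, NNReal.coe_min]
    constructor
    · grind
    · grind
  have hL : ∀ ω, f.integral B s ω * g.integral B t ω = ∑ k ∈ Finset.range f.n,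
      ∑ l ∈ Finset.range g.n, (f.coef k * g.coef l) *
        ((B (min (f.time (k + 1)) s) ω - B (min (f.time k) s) ω) *
          (B (min (g.time (l + 1)) t) ω - B (min (g.time l) t) ω)) := by
    intro ω
    unfold StepFunction.integral
    rw [Finset.sum_mul_sum]
    exact Finset.sum_congr rfl fun k _ => Finset.sum_congr rfl fun l _ => by ring
  have hR : ∀ u, f.toFun u * g.toFun u = ∑ k ∈ Finset.range f.n,
      ∑ l ∈ Finset.range g.n, (f.coef k * g.coef l) *
        ((Set.Ioc (f.time k : ℝ) (f.time (k + 1))).indicator (fun _ => (1 : ℝ)) u *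
          (Set.Ioc (g.time l : ℝ) (g.time (l + 1))).indicator (fun _ => (1 : ℝ)) u) := by
    intro u
    unfold StepFunction.toFun
    rw [Finset.sum_mul_sum]
    refine Finset.sum_congr rfl fun k _ => Finset.sum_congr rfl fun l _ => ?_
    simp only [Set.indicator_apply]
    split_ifs <;> simp
  simp_rw [hL, hR]
  have m1 : ∀ a b : ℝ, MemLp ((Set.Ioc a b).indicator (fun _ => (1 : ℝ))) 2
      (volume.restrict (Set.Ioc (0 : ℝ) (min s t : ℝ≥0))) := fun a b =>
    (memLp_const _).indicator measurableSet_Ioc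
  have i : ∀ a b c d, Integrable (fun ω => (B b ω - B a ω) * (B d ω - B c ω)) P :=
    fun a b c d => (m a b).integrable_mul (m c d)
  have i1 : ∀ a b c d : ℝ, Integrable (fun u => (Set.Ioc a b).indicator (fun _ => (1 : ℝ)) u *
      (Set.Ioc c d).indicator (fun _ => (1 : ℝ)) u)
      (volume.restrict (Set.Ioc (0 : ℝ) (min s t : ℝ≥0))) :=
    fun a b c d => (m1 a b).integrable_mul (m1 c d)
  rw [integral_finsetSum _ fun k _ => integrable_finsetSum _ fun l _ => (i _ _ _ _).const_mul _,
    integral_finsetSum _ fun k _ => integrable_finsetSum _ fun l _ => (i1 _ _ _ _).const_mul _]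
  refine Finset.sum_congr rfl fun k _ => ?_
  rw [integral_finsetSum _ fun l _ => (i _ _ _ _).const_mul _,
    integral_finsetSum _ fun l _ => (i1 _ _ _ _).const_mul _]
  refine Finset.sum_congr rfl fun l _ => ?_
  rw [integral_const_mul, integral_const_mul, step]

/-- A version of the Itô integral process of `σ`, not necessarily with continuous paths. -/
structure IsWienerIntegral (σ : ℝ → ℝ) (B : ℝ≥0 → Ω → ℝ)
    (J : unitInterval → Ω → ℝ) (P : Measure Ω) : Prop where
  measurable : ∀ t, Measurable (J t)
  limit : ∃ f : ℕ → StepFunction,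
    Tendsto (fun n => eLpNorm (fun u => (f n).toFun u - σ u) 2
      (volume.restrict (Set.Icc (0 : ℝ) 1))) atTop (𝓝 0) ∧
    ∀ t : unitInterval, Tendsto (fun n => eLpNorm
      (fun ω => (f n).integral B (unitInterval.toNNReal t) ω - J t ω) 2 P) atTop (𝓝 0)

lemma IsItoIntegral.isWienerIntegral {σ : ℝ → ℝ} {B : ℝ≥0 → Ω → ℝ}
    {J : unitInterval → Ω → ℝ} (h : IsItoIntegral σ B J P) : IsWienerIntegral σ B J P :=
  ⟨h.measurable, h.limit⟩

/-! ### The Itô isometry in the limit and second moments of increments. -/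

section WienerIntegral

variable {σ : ℝ → ℝ} {B : ℝ≥0 → Ω → ℝ} {J K : unitInterval → Ω → ℝ}

lemma IsWienerIntegral.memLp (h : IsWienerIntegral σ B J P) (hB : IsPreBrownianReal B P)
    (t : unitInterval) : MemLp (J t) 2 P := by
  obtain ⟨f, -, hf⟩ := h.limit
  exact memLp_of_tendsto_eLpNorm_sub (fun n => (f n).memLp_integral hB _)
    (h.measurable t).aestronglyMeasurable (hf t)

lemma G_eq_setIntegral (σ : ℝ → ℝ) (t : unitInterval) :
    G σ t = ∫ u in Set.Ioc (0 : ℝ) t, σ u * σ u := by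
  rw [G, intervalIntegral.integral_of_le t.2.1]
  simp_rw [sq]

lemma tendsto_eLpNorm_Ioc {f : ℕ → ℝ → ℝ} (t : unitInterval)
    (h : Tendsto (fun n => eLpNorm (f n) 2 (volume.restrict (Set.Icc (0 : ℝ) 1))) atTop (𝓝 0)) :
    Tendsto (fun n => eLpNorm (f n) 2 (volume.restrict (Set.Ioc (0 : ℝ) t))) atTop (𝓝 0) :=
  tendsto_of_tendsto_of_tendsto_of_le_of_le tendsto_const_nhds h (fun _ => zero_le)
    fun _ => eLpNorm_mono_measure _ (Measure.restrict_mono_set _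
      (Set.Ioc_subset_Icc_self.trans (Set.Icc_subset_Icc_right t.2.2)))

/-- The Itô isometry. -/
lemma IsWienerIntegral.integral_mul (hJ : IsWienerIntegral σ B J P)
    (hK : IsWienerIntegral σ B K P) (hσ : Measurable σ) (hB : IsPreBrownianReal B P)
    (s t : unitInterval) : ∫ ω, J s ω * K t ω ∂P = G σ (min s t) := by
  have mJ := hJ.memLp hB
  have mK := hK.memLp hB
  obtain ⟨f, hf, hfJ⟩ := hJ.limit
  obtain ⟨g, hg, hgK⟩ := hK.limit
  have mσ := memLp_of_tendsto_eLpNorm_sub (fun n => (f n).memLp_toFun _)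
    hσ.aestronglyMeasurable hf
  have hsub : volume.restrict (Set.Ioc (0 : ℝ) (min s t : unitInterval)) ≤
      volume.restrict (Set.Icc (0 : ℝ) 1) := Measure.restrict_mono_set _
      (Set.Ioc_subset_Icc_self.trans (Set.Icc_subset_Icc_right (min s t).2.2))
  have t1 := tendsto_integral_mul (fun n => (f n).memLp_integral hB _)
    (fun n => (g n).memLp_integral hB _) (mJ s) (mK t) (hfJ s) (hgK t)
  have t2 := tendsto_integral_mul (fun n => (f n).memLp_toFun _)
    (fun n => (g n).memLp_toFun _) (mσ.mono_measure hsub) (mσ.mono_measure hsub)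
    (tendsto_eLpNorm_Ioc (min s t) hf) (tendsto_eLpNorm_Ioc (min s t) hg)
  rw [G_eq_setIntegral]
  refine tendsto_nhds_unique t1 ?_
  refine t2.congr fun n => ?_
  rw [StepFunction.integral_mul_integral _ _ hB]
  congr 3

/-- The isometry holds across two versions with different approximating sequences, so all four terms
of `𝔼 (J t - K t) ^ 2` equal `G σ t` and cancel. -/
lemma IsWienerIntegral.ae_eq (hJ : IsWienerIntegral σ B J P)
    (hK : IsWienerIntegral σ B K P) (hσ : Measurable σ) (hB : IsPreBrownianReal B P)
    (t : unitInterval) : J t =ᵐ[P] K t := by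
  have mJ := hJ.memLp hB t
  have mK := hK.memLp hB t
  have h0 : ∫ ω, (J t ω - K t ω) ^ 2 ∂P = 0 := by
    simp_rw [sq]
    rw [FunctionalSV.integral_sub_mul_sub mJ mK mJ mK,
      hJ.integral_mul hJ hσ hB, hJ.integral_mul hK hσ hB, hK.integral_mul hJ hσ hB,
      hK.integral_mul hK hσ hB]
    ring
  have := eLpNorm_two_eq_zero_of_integral_sq (f := fun ω => J t ω - K t ω) (mJ.sub mK) h0
  filter_upwards [this] with ω h
  exact sub_eq_zero.1 h

lemma IsWienerIntegral.integral_eq_zero (hJ : IsWienerIntegral σ B J P)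
    (hB : IsPreBrownianReal B P) (t : unitInterval) : ∫ ω, J t ω ∂P = 0 := by
  have := hB.isGaussianProcess.isProbabilityMeasure
  have mJ := hJ.memLp hB t
  obtain ⟨f, hf, hfJ⟩ := hJ.limit
  have t1 := tendsto_integral_mul (fun n => (f n).memLp_integral hB _)
    (fun _ => memLp_const (1 : ℝ)) mJ (memLp_const (1 : ℝ)) (hfJ t) (by simp)
  simp only [mul_one, StepFunction.integral_integral _ hB] at t1
  exact (tendsto_nhds_unique tendsto_const_nhds t1).symm

lemma IsWienerIntegral.integral_sub_mul_sub (hJ : IsWienerIntegral σ B J P) (hσ : Measurable σ)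
    (hB : IsPreBrownianReal B P) (a b c d : unitInterval) :
    ∫ ω, (J b ω - J a ω) * (J d ω - J c ω) ∂P =
      G σ (min b d) - G σ (min b c) - G σ (min a d) + G σ (min a c) := by
  rw [FunctionalSV.integral_sub_mul_sub (hJ.memLp hB _) (hJ.memLp hB _) (hJ.memLp hB _)
    (hJ.memLp hB _)]
  simp_rw [hJ.integral_mul hJ hσ hB]

lemma IsWienerIntegral.integral_sub_sq (hJ : IsWienerIntegral σ B J P) (hσ : Measurable σ)
    (hB : IsPreBrownianReal B P) {s t : unitInterval} (hst : s ≤ t) :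
    ∫ ω, (J t ω - J s ω) ^ 2 ∂P = G σ t - G σ s := by
  simp_rw [sq]
  rw [hJ.integral_sub_mul_sub hσ hB]
  simp [hst]

end WienerIntegral

/-! ### Gaussian limits, fourth moments, and products in probability. -/

section GaussianLimits

variable {Ω : Type u} [MeasurableSpace Ω] {P : Measure Ω}

/-- A functional on a finite product is a combination of coordinates, so Minkowski's inequality
suffices. It reduces joint Gaussianity to the one-dimensional case. -/
lemma tendsto_eLpNorm_pi_dual {ι : Type*} [Fintype ι] {X : ℕ → Ω → ι → ℝ} {Y : Ω → ι → ℝ}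
    (hX : ∀ n i, MemLp (fun ω => X n ω i) 2 P) (hY : ∀ i, MemLp (fun ω => Y ω i) 2 P)
    (h : ∀ i, Tendsto (fun n => eLpNorm (fun ω => X n ω i - Y ω i) 2 P) atTop (𝓝 0))
    (L : (ι → ℝ) →L[ℝ] ℝ) :
    Tendsto (fun n => eLpNorm (fun ω => L (X n ω) - L (Y ω)) 2 P) atTop (𝓝 0) := by
  classical
  set c : ι → ℝ := fun i => L (fun j => if i = j then 1 else 0) with hc
  have hL : ∀ x, L x = ∑ i, x i * c i := fun x => by
    simpa using (L : (ι → ℝ) →ₗ[ℝ] ℝ).pi_apply_eq_sum_univ x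
  have hle : ∀ n, eLpNorm (fun ω => L (X n ω) - L (Y ω)) 2 P ≤
      ∑ i, ‖c i‖ₑ * eLpNorm (fun ω => X n ω i - Y ω i) 2 P := by
    intro n
    have : (fun ω => L (X n ω) - L (Y ω)) =
        ∑ i, c i • fun ω => X n ω i - Y ω i := by
      ext ω
      simp only [hL, Finset.sum_apply, Pi.smul_apply, smul_eq_mul, ← Finset.sum_sub_distrib]
      exact Finset.sum_congr rfl fun i _ => by ring
    rw [this]
    refine (eLpNorm_sum_le (fun i _ => (((hX n i).sub (hY i)).const_smul _).1) (by norm_num)).trans ?_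
    exact Finset.sum_le_sum fun i _ => (eLpNorm_const_smul _ _ _ _).le
  refine tendsto_of_tendsto_of_tendsto_of_le_of_le tendsto_const_nhds ?_ (fun _ => zero_le) hle
  have hi : ∀ i, Tendsto (fun n => ‖c i‖ₑ * eLpNorm (fun ω => X n ω i - Y ω i) 2 P) atTop (𝓝 0) :=
    fun i => by simpa using ENNReal.Tendsto.const_mul (h i) (Or.inr (enorm_ne_top (x := c i)))
  simpa using tendsto_finsetSum Finset.univ fun i _ => hi i

/-- Means and variances converge, hence so do the Gaussian characteristic functions; convergence in
law identifies their limit. A zero limiting variance is allowed. -/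
lemma hasGaussianLaw_of_tendsto_eLpNorm [IsProbabilityMeasure P] {X : ℕ → Ω → ℝ} {Y : Ω → ℝ}
    (hX : ∀ n, HasGaussianLaw (X n) P) (hY : MemLp Y 2 P)
    (h : Tendsto (fun n => eLpNorm (fun ω => X n ω - Y ω) 2 P) atTop (𝓝 0)) :
    HasGaussianLaw Y P := by
  have mX : ∀ n, MemLp (X n) 2 P := fun n => (hX n).memLp_two
  have hm : Tendsto (fun n => ∫ ω, X n ω ∂P) atTop (𝓝 (∫ ω, Y ω ∂P)) := by
    simpa using tendsto_integral_mul mX (fun _ => memLp_const (1 : ℝ)) hY (memLp_const (1 : ℝ)) h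
      (by simp)
  have hs := tendsto_integral_mul mX mX hY hY h h
  have hv : Tendsto (fun n => Var[X n; P]) atTop (𝓝 (Var[Y; P])) := by
    rw [variance_eq_sub hY]
    simp_rw [fun n => variance_eq_sub (mX n)]
    simpa [sq] using hs.sub (hm.mul hm)
  have hd := (tendstoInMeasure_of_tendsto_eLpNorm two_ne_zero (fun n => (mX n).1) hY.1
    h).tendstoInDistribution (fun n => (mX n).1.aemeasurable)
  have : P.map Y = gaussianReal (∫ ω, Y ω ∂P) (Var[Y; P]).toNNReal := by
    have := Measure.isProbabilityMeasure_map (μ := P) hY.1.aemeasurable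
    refine Measure.ext_of_charFun (funext fun t => ?_)
    have h1 := ProbabilityMeasure.tendsto_iff_tendsto_charFun.1 hd.tendsto t
    refine tendsto_nhds_unique h1 ?_
    simp only [ProbabilityMeasure.coe_mk, (hX _).map_eq_gaussianReal, charFun_gaussianReal,
      Real.coe_toNNReal _ (variance_nonneg _ _)]
    refine (Complex.continuous_exp.tendsto _).comp ?_
    have hm' : Tendsto (fun n => ((∫ ω, X n ω ∂P : ℝ) : ℂ)) atTop (𝓝 ((∫ ω, Y ω ∂P : ℝ) : ℂ)) :=
      (Complex.continuous_ofReal.tendsto _).comp hm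
    have hv' : Tendsto (fun n => ((Var[X n; P] : ℝ) : ℂ)) atTop (𝓝 ((Var[Y; P] : ℝ) : ℂ)) :=
      (Complex.continuous_ofReal.tendsto _).comp hv
    exact ((hm'.const_mul _).mul_const _).sub ((hv'.mul_const _).div_const _)
  exact HasLaw.hasGaussianLaw (μ := gaussianReal (∫ ω, Y ω ∂P) (Var[Y; P]).toNNReal)
    ⟨hY.1.aemeasurable, this⟩

/-- The fourth moment of the standard normal distribution. -/
noncomputable def normalFourthMoment : ℝ := ∫ x, x ^ 4 ∂gaussianReal 0 1

lemma normalFourthMoment_nonneg : 0 ≤ normalFourthMoment :=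
  integral_nonneg fun x => by positivity

/-- By scaling from the standard normal. The value of the constant never matters, only that it is
nonnegative. -/
lemma HasGaussianLaw.integral_pow_four {X : Ω → ℝ} (hX : HasGaussianLaw X P)
    (h0 : ∫ ω, X ω ∂P = 0) :
    ∫ ω, X ω ^ 4 ∂P = normalFourthMoment * (∫ ω, X ω ^ 2 ∂P) ^ 2 := by
  have := hX.isProbabilityMeasure
  have hv : Var[X; P] = ∫ ω, X ω ^ 2 ∂P := by
    rw [variance_eq_sub hX.memLp_two, h0]; simp
  have hmap := hX.map_eq_gaussianReal
  have hg := gaussianReal_map_const_mul (μ := 0) (v := 1) (Real.sqrt Var[X; P])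
  have hlaw : P.map X = (gaussianReal 0 1).map (Real.sqrt Var[X; P] * ·) := by
    rw [hmap, hg, h0, mul_zero, mul_one]
    congr 1
    ext
    simp [Real.sq_sqrt (variance_nonneg X P)]
  have h1 : ∫ ω, X ω ^ 4 ∂P = ∫ x, x ^ 4 ∂(P.map X) := by
    rw [integral_map hX.aemeasurable (by fun_prop)]
  rw [h1, hlaw, integral_map (by fun_prop) (by fun_prop)]
  simp_rw [mul_pow]
  rw [integral_const_mul, ← hv, normalFourthMoment, mul_comm]
  congr 1
  rw [show (4 : ℕ) = 2 * 2 from rfl, pow_mul, Real.sq_sqrt (variance_nonneg X P)]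

/-- The factor `h` may be unbounded, so the argument goes through a.e. convergent subsequences. -/
lemma TendstoInMeasure.mul_left [IsFiniteMeasure P] {f : ℕ → Ω → ℝ} {g h : Ω → ℝ}
    (hf : ∀ n, AEStronglyMeasurable (f n) P) (hh : AEStronglyMeasurable h P)
    (hfg : TendstoInMeasure P f atTop g) :
    TendstoInMeasure P (fun n ω => h ω * f n ω) atTop (fun ω => h ω * g ω) := by
  refine (exists_seq_tendstoInMeasure_atTop_iff fun n => hh.mul (hf n)).2 fun ns hns => ?_
  obtain ⟨ns', h1, h2⟩ := (exists_seq_tendstoInMeasure_atTop_iff hf).1 hfg ns hns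
  refine ⟨ns', h1, ?_⟩
  filter_upwards [h2] with ω hω
  exact hω.const_mul _

end GaussianLimits

/-! ### Regularity of the cumulative volatility. -/

section CumulativeVolatility

variable {σ : ℝ → ℝ}

lemma integrableOn_sq_of_bounded (hσ : Measurable σ)
    (h0 : ∀ t ∈ Set.Icc (0 : ℝ) 1, 0 ≤ σ t) (hb : ∃ C : ℝ, ∀ t ∈ Set.Icc (0 : ℝ) 1, σ t ≤ C) :
    IntegrableOn (fun u => σ u ^ 2) (Set.Icc 0 1) := by
  obtain ⟨C, hC⟩ := hb
  refine Measure.integrableOn_of_bounded (M := C ^ 2) (by simp) (hσ.pow_const 2).aestronglyMeasurable ?_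
  filter_upwards [ae_restrict_mem measurableSet_Icc] with u hu
  rw [Real.norm_of_nonneg (sq_nonneg _)]
  exact pow_le_pow_left₀ (h0 u hu) (hC u hu) 2

lemma intervalIntegrable_sq {s t : unitInterval}
    (hi : IntegrableOn (fun u => σ u ^ 2) (Set.Icc 0 1)) :
    IntervalIntegrable (fun u => σ u ^ 2) volume (s : ℝ) t :=
  (hi.mono_set (Set.uIcc_subset_Icc s.2 t.2)).intervalIntegrable

lemma G_sub (hi : IntegrableOn (fun u => σ u ^ 2) (Set.Icc 0 1)) (s t : unitInterval) :
    G σ t - G σ s = ∫ u in (s : ℝ)..t, σ u ^ 2 :=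
  intervalIntegral.integral_interval_sub_left (intervalIntegrable_sq (s := 0) hi)
    (intervalIntegrable_sq (s := 0) hi)

lemma G_zero : G σ 0 = 0 := by simp [G]

lemma G_mono (hi : IntegrableOn (fun u => σ u ^ 2) (Set.Icc 0 1)) : Monotone (G σ) := by
  intro s t hst
  rw [← sub_nonneg, G_sub hi]
  exact intervalIntegral.integral_nonneg hst fun u _ => sq_nonneg _

lemma G_nonneg (hi : IntegrableOn (fun u => σ u ^ 2) (Set.Icc 0 1)) (t : unitInterval) :
    0 ≤ G σ t := by
  have := G_mono hi (show 0 ≤ t from t.2.1)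
  rwa [G_zero] at this

/-- Boundedness of `σ` makes `G σ` Lipschitz. This drives both the vanishing variance of squared
sums and the path continuity. -/
lemma exists_G_sub_le (hσ : Measurable σ)
    (h0 : ∀ t ∈ Set.Icc (0 : ℝ) 1, 0 ≤ σ t) (hb : ∃ C : ℝ, ∀ t ∈ Set.Icc (0 : ℝ) 1, σ t ≤ C) :
    ∃ C : ℝ, 0 ≤ C ∧ ∀ s t : unitInterval, s ≤ t → G σ t - G σ s ≤ C * ((t : ℝ) - s) := by
  have hi := integrableOn_sq_of_bounded hσ h0 hb
  obtain ⟨C, hC⟩ := hb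
  refine ⟨C ^ 2, sq_nonneg _, fun s t hst => ?_⟩
  rw [G_sub hi]
  have : ∫ u in (s : ℝ)..t, σ u ^ 2 ≤ ∫ u in (s : ℝ)..t, C ^ 2 := by
    refine intervalIntegral.integral_mono_on hst (intervalIntegrable_sq hi)
      intervalIntegrable_const fun u hu => ?_
    have hu' : u ∈ Set.Icc (0 : ℝ) 1 := ⟨s.2.1.trans hu.1, hu.2.trans t.2.2⟩
    exact pow_le_pow_left₀ (h0 u hu') (hC u hu') 2
  simpa [mul_comm] using this

lemma continuous_G (hi : IntegrableOn (fun u => σ u ^ 2) (Set.Icc 0 1)) : Continuous (G σ) := by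
  have h := intervalIntegral.continuousOn_primitive (a := 0) (b := 1) hi
  have h2 : Continuous fun t : unitInterval => ∫ u in Set.Ioc (0 : ℝ) t, σ u ^ 2 :=
    continuousOn_iff_continuous_domRestrict.1 h
  refine h2.congr fun t => ?_
  rw [G, intervalIntegral.integral_of_le t.2.1]

end CumulativeVolatility

/-! ### Independent Gaussian increments and the quadratic variation of the integral. -/

section QuadraticVariation

variable {Ω : Type u} [MeasurableSpace Ω] {P : Measure Ω} {σ : ℝ → ℝ} {B : ℝ≥0 → Ω → ℝ}
  {J : unitInterval → Ω → ℝ}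

/-- Cramér–Wold: every linear functional of finitely many values is an `L²` limit of Gaussian
variables. -/
lemma IsWienerIntegral.isGaussianProcess (hJ : IsWienerIntegral σ B J P)
    (hB : IsPreBrownianReal B P) : IsGaussianProcess J P where
  hasGaussianLaw I := by
    have := hB.isGaussianProcess.isProbabilityMeasure
    have mJ := hJ.memLp hB
    obtain ⟨f, -, hf⟩ := hJ.limit
    have hm : Measurable fun ω => I.restrict (J · ω) :=
      measurable_pi_lambda _ fun i => hJ.measurable i
    refine ⟨isGaussian_of_isGaussian_map fun L => ?_⟩
    rw [Measure.map_map L.measurable hm]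
    have hG : ∀ n, HasGaussianLaw
        (fun ω (i : I) => (f n).integral B (unitInterval.toNNReal i) ω) P := fun n =>
      (((f n).isGaussianProcess_integral hB).comp_right unitInterval.toNNReal).hasGaussianLaw I
    have key := hasGaussianLaw_of_tendsto_eLpNorm (Y := fun ω => L (I.restrict (J · ω)))
      (fun n => (hG n).map_fun L) ?_ (tendsto_eLpNorm_pi_dual
        (X := fun n ω (i : I) => (f n).integral B (unitInterval.toNNReal i) ω)
        (Y := fun ω => I.restrict (J · ω))
        (fun n i => (f n).memLp_integral hB _) (fun i => mJ i) (fun i => hf i) L)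
    · exact key.isGaussian_map
    · classical
      have hL : ∀ x : I → ℝ, L x = ∑ i, x i * L (fun j => if i = j then 1 else 0) := fun x => by
        simpa using (L : (I → ℝ) →ₗ[ℝ] ℝ).pi_apply_eq_sum_univ x
      rw [show (fun ω => L (I.restrict (J · ω))) = fun ω => ∑ i : I, J i ω *
        L (fun j => if i = j then 1 else 0) from funext fun ω => hL _]
      exact memLp_finsetSum _ fun i _ => (mJ i).mul_const _

lemma IsWienerIntegral.integral_sub_pow_four (hJ : IsWienerIntegral σ B J P) (hσ : Measurable σ)
    (hB : IsPreBrownianReal B P) {s t : unitInterval} (hst : s ≤ t) :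
    ∫ ω, (J t ω - J s ω) ^ 4 ∂P = normalFourthMoment * (G σ t - G σ s) ^ 2 := by
  have := hB.isGaussianProcess.isProbabilityMeasure
  rw [← hJ.integral_sub_sq hσ hB hst]
  refine HasGaussianLaw.integral_pow_four (hJ.isGaussianProcess hB).hasGaussianLaw_fun_sub ?_
  rw [integral_sub ((hJ.memLp hB t).integrable (by norm_num))
    ((hJ.memLp hB s).integrable (by norm_num)), hJ.integral_eq_zero hB, hJ.integral_eq_zero hB,
    sub_zero]

lemma IsWienerIntegral.memLp_sub_four (hJ : IsWienerIntegral σ B J P)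
    (hB : IsPreBrownianReal B P) (s t : unitInterval) : MemLp (fun ω => J t ω - J s ω) 4 P :=
  (hJ.isGaussianProcess hB).hasGaussianLaw_fun_sub.memLp (by norm_num)

lemma IsWienerIntegral.memLp_sub_sq (hJ : IsWienerIntegral σ B J P)
    (hB : IsPreBrownianReal B P) (s t : unitInterval) :
    MemLp (fun ω => (J t ω - J s ω) ^ 2) 2 P := by
  have h := hJ.memLp_sub_four hB s t
  refine (memLp_two_iff_integrable_sq (h.1.pow 2)).2 ?_
  have := h.integrable_norm_pow (p := 4) (by norm_num)
  refine this.congr (Eventually.of_forall fun ω => ?_)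
  simp only [Real.norm_eq_abs, Pi.pow_apply]
  rw [← pow_mul, Even.pow_abs (by decide)]

/-- The two increments are jointly Gaussian and their covariance `G b - G b - G a + G a` is zero. -/
lemma IsWienerIntegral.indepFun_increments (hJ : IsWienerIntegral σ B J P) (hσ : Measurable σ)
    (hB : IsPreBrownianReal B P) {a b c d : unitInterval} (hab : a ≤ b) (hbc : b ≤ c)
    (hcd : c ≤ d) :
    IndepFun (fun ω => J b ω - J a ω) (fun ω => J d ω - J c ω) P := by
  classical
  have := hB.isGaussianProcess.isProbabilityMeasure
  let L : (({a, b, c, d} : Finset unitInterval) → ℝ) →L[ℝ] ℝ × ℝ :=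
    { toFun := fun x => (x ⟨b, by simp⟩ - x ⟨a, by simp⟩, x ⟨d, by simp⟩ - x ⟨c, by simp⟩)
      map_add' := fun x y => by ext <;> simp <;> ring
      map_smul' := fun r x => by ext <;> simp <;> ring }
  have hG : HasGaussianLaw (fun ω => (J b ω - J a ω, J d ω - J c ω)) P :=
    ((hJ.isGaussianProcess hB).hasGaussianLaw {a, b, c, d}).map_fun L
  refine hG.indepFun_of_covariance_eq_zero ?_
  have i := fun t => (hJ.memLp hB t).integrable (q := 2) (by norm_num)
  have m : ∀ s t, MemLp (fun ω => J s ω - J t ω) 2 P := fun s t =>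
    (hJ.memLp hB s).sub (hJ.memLp hB t)
  rw [covariance_eq_sub (m b a) (m d c), integral_sub (i b) (i a)]
  have := hJ.integral_sub_mul_sub hσ hB a b c d
  simp only [Pi.mul_apply]
  rw [this, hJ.integral_eq_zero hB, hJ.integral_eq_zero hB]
  simp [hbc, hab.trans hbc, hbc.trans hcd, hab.trans (hbc.trans hcd)]

/-- Independence makes the variances add, and the variance of a squared increment is at most its
fourth moment. -/
lemma IsWienerIntegral.variance_sum_sq_increments_le (hJ : IsWienerIntegral σ B J P)
    (hσ : Measurable σ) (hB : IsPreBrownianReal B P) {τ : ℕ → unitInterval} (hτ : Monotone τ)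
    (N : ℕ) :
    Var[fun ω => ∑ k ∈ Finset.range N, (J (τ (k + 1)) ω - J (τ k) ω) ^ 2; P] ≤
      ∑ k ∈ Finset.range N, normalFourthMoment * (G σ (τ (k + 1)) - G σ (τ k)) ^ 2 := by
  have := hB.isGaussianProcess.isProbabilityMeasure
  have e : (fun ω => ∑ k ∈ Finset.range N, (J (τ (k + 1)) ω - J (τ k) ω) ^ 2) =
      ∑ k ∈ Finset.range N, fun ω => (J (τ (k + 1)) ω - J (τ k) ω) ^ 2 := by
    ext ω; simp
  rw [e, IndepFun.variance_sum (fun k _ => hJ.memLp_sub_sq hB _ _)]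
  · refine Finset.sum_le_sum fun k _ => ?_
    rw [← hJ.integral_sub_pow_four hσ hB (hτ (Nat.le_succ k))]
    refine (variance_le_expectation_sq (hJ.memLp_sub_sq hB _ _).1).trans (le_of_eq ?_)
    refine integral_congr_ae (Eventually.of_forall fun ω => ?_)
    simp only [Pi.pow_apply]
    ring
  · have key : ∀ k l, k < l → IndepFun (fun ω => (J (τ (k + 1)) ω - J (τ k) ω) ^ 2)
        (fun ω => (J (τ (l + 1)) ω - J (τ l) ω) ^ 2) P := fun k l hkl =>
      (hJ.indepFun_increments hσ hB (hτ (Nat.le_succ k)) (hτ hkl) (hτ (Nat.le_succ l))).comp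
        (φ := fun x => x ^ 2) (ψ := fun x => x ^ 2) (by fun_prop) (by fun_prop)
    intro k _ l _ hkl
    rcases lt_or_gt_of_ne hkl with h | h
    · exact key k l h
    · exact (key l k h).symm

lemma IsWienerIntegral.integral_sum_sq_increments (hJ : IsWienerIntegral σ B J P)
    (hσ : Measurable σ) (hB : IsPreBrownianReal B P) {τ : ℕ → unitInterval} (hτ : Monotone τ)
    (N : ℕ) :
    ∫ ω, ∑ k ∈ Finset.range N, (J (τ (k + 1)) ω - J (τ k) ω) ^ 2 ∂P = G σ (τ N) - G σ (τ 0) := by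
  have := hB.isGaussianProcess.isProbabilityMeasure
  rw [integral_finsetSum _ fun k _ => (hJ.memLp_sub_sq hB _ _).integrable (by norm_num)]
  simp_rw [fun k => hJ.integral_sub_sq hσ hB (hτ (Nat.le_succ k))]
  exact Finset.sum_range_sub (fun k => G σ (τ k)) N

/-- The sums of squared increments of the Itô integral of a deterministic bounded `σ` tend to
`G σ` in probability. -/
lemma IsWienerIntegral.tendstoInMeasure_sum_sq_increments (hJ : IsWienerIntegral σ B J P)
    (hσ : Measurable σ) (h0 : ∀ t ∈ Set.Icc (0 : ℝ) 1, 0 ≤ σ t)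
    (hb : ∃ C : ℝ, ∀ t ∈ Set.Icc (0 : ℝ) 1, σ t ≤ C) (hB : IsPreBrownianReal B P)
    (t : unitInterval) (N : ℕ → ℕ) (τ : ℕ → ℕ → unitInterval) (hmono : ∀ n, Monotone (τ n))
    (hzero : ∀ n, τ n 0 = 0) (hend : ∀ n, τ n (N n) = t)
    (hmesh : ∀ δ : ℝ, 0 < δ → ∀ᶠ n in atTop, ∀ k < N n, (τ n (k + 1) : ℝ) - (τ n k : ℝ) < δ) :
    TendstoInMeasure P
      (fun n ω => ∑ k ∈ Finset.range (N n), (J (τ n (k + 1)) ω - J (τ n k) ω) ^ 2)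
      atTop (fun _ => G σ t) := by
  have := hB.isGaussianProcess.isProbabilityMeasure
  have hi := integrableOn_sq_of_bounded hσ h0 hb
  obtain ⟨C, hC0, hC⟩ := exists_G_sub_le hσ h0 hb
  set V : ℕ → ℝ := fun n =>
    Var[fun ω => ∑ k ∈ Finset.range (N n), (J (τ n (k + 1)) ω - J (τ n k) ω) ^ 2; P] with hV
  have hVδ : ∀ δ : ℝ, 0 < δ → ∀ᶠ n in atTop, V n ≤ δ * (normalFourthMoment * C * G σ t) := by
    intro δ hδ
    filter_upwards [hmesh δ hδ] with n hn
    refine (hJ.variance_sum_sq_increments_le hσ hB (hmono n) (N n)).trans ?_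
    have hsum : ∑ k ∈ Finset.range (N n), (G σ (τ n (k + 1)) - G σ (τ n k)) = G σ t := by
      rw [Finset.sum_range_sub (fun k => G σ (τ n k)), hend, hzero, G_zero, sub_zero]
    -- One factor of each square is at most `C * δ`; the other telescopes to `G σ t`.
    calc ∑ k ∈ Finset.range (N n), normalFourthMoment * (G σ (τ n (k + 1)) - G σ (τ n k)) ^ 2
        ≤ ∑ k ∈ Finset.range (N n),
          δ * (normalFourthMoment * C) * (G σ (τ n (k + 1)) - G σ (τ n k)) := by
          refine Finset.sum_le_sum fun k hk => ?_
          have h1 := hC _ _ (hmono n (Nat.le_succ k))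
          have h2 : 0 ≤ G σ (τ n (k + 1)) - G σ (τ n k) :=
            sub_nonneg.2 (G_mono hi (hmono n (Nat.le_succ k)))
          have h3 := (hn k (Finset.mem_range.1 hk)).le
          have h4 : G σ (τ n (k + 1)) - G σ (τ n k) ≤ C * δ :=
            h1.trans (mul_le_mul_of_nonneg_left h3 hC0)
          calc normalFourthMoment * (G σ (τ n (k + 1)) - G σ (τ n k)) ^ 2
              = normalFourthMoment * ((G σ (τ n (k + 1)) - G σ (τ n k)) *
                (G σ (τ n (k + 1)) - G σ (τ n k))) := by ring
            _ ≤ normalFourthMoment * ((C * δ) * (G σ (τ n (k + 1)) - G σ (τ n k))) :=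
                mul_le_mul_of_nonneg_left (mul_le_mul_of_nonneg_right h4 h2)
                  normalFourthMoment_nonneg
            _ = _ := by ring
      _ = δ * (normalFourthMoment * C * G σ t) := by
          rw [← Finset.mul_sum, hsum]; ring
  have hV0 : Tendsto V atTop (𝓝 0) := by
    set M := normalFourthMoment * C * G σ t with hM
    have hM0 : 0 ≤ M := mul_nonneg (mul_nonneg normalFourthMoment_nonneg hC0) (G_nonneg hi t)
    refine tendsto_order.2 ⟨fun a ha => Eventually.of_forall fun n =>
      ha.trans_le (variance_nonneg _ _), fun a ha => ?_⟩
    -- The `+ 1` covers `M = 0` and leaves a strict inequality.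
    filter_upwards [hVδ (a / (M + 1)) (by positivity)] with n hn
    refine hn.trans_lt ?_
    rw [div_mul_eq_mul_div, div_lt_iff₀ (by positivity)]
    nlinarith
  rw [tendstoInMeasure_iff_dist]
  intro ε hε
  have hlim : Tendsto (fun n => ENNReal.ofReal (V n / ε ^ 2)) atTop (𝓝 0) := by
    have := ENNReal.tendsto_ofReal (hV0.div_const (ε ^ 2))
    simpa using this
  refine tendsto_of_tendsto_of_tendsto_of_le_of_le tendsto_const_nhds hlim
    (fun _ => zero_le) fun n => ?_
  have hmem : MemLp (fun ω => ∑ k ∈ Finset.range (N n), (J (τ n (k + 1)) ω - J (τ n k) ω) ^ 2)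
      2 P := memLp_finsetSum _ fun k _ => hJ.memLp_sub_sq hB _ _
  -- The mean of the sum is exactly `G σ t`, so Chebyshev bounds the distance to the limit itself.
  have := meas_ge_le_variance_div_sq hmem hε
  rw [hJ.integral_sum_sq_increments hσ hB (hmono n), hend, hzero, G_zero, sub_zero] at this
  exact this

end QuadraticVariation

/-! ### `L²` norms as integrals of squares. -/

section LTwo

variable {α : Type*} [MeasurableSpace α] {μ : Measure α}

lemma norm_toLp_sq {f : α → ℝ} (hf : MemLp f 2 μ) : ‖hf.toLp f‖ ^ 2 = ∫ x, f x ^ 2 ∂μ := by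
  rw [← real_inner_self_eq_norm_sq, L2.inner_def]
  refine integral_congr_ae ?_
  filter_upwards [hf.coeFn_toLp] with x hx
  simp [hx, sq]

lemma dist_toLp_sq {f g : α → ℝ} (hf : MemLp f 2 μ) (hg : MemLp g 2 μ) :
    dist (hf.toLp f) (hg.toLp g) ^ 2 = ∫ x, (f x - g x) ^ 2 ∂μ := by
  rw [dist_eq_norm, ← MemLp.toLp_sub, norm_toLp_sq]
  rfl

lemma tendsto_eLpNorm_two_of_integral_sq {X : ℕ → α → ℝ} (hX : ∀ n, MemLp (X n) 2 μ)
    (h : Tendsto (fun n => ∫ x, X n x ^ 2 ∂μ) atTop (𝓝 0)) :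
    Tendsto (fun n => eLpNorm (X n) 2 μ) atTop (𝓝 0) := by
  have h1 : ∀ n, eLpNorm (X n) 2 μ = ENNReal.ofReal (Real.sqrt (∫ x, X n x ^ 2 ∂μ)) := by
    intro n
    rw [← norm_toLp_sq (hX n), Real.sqrt_sq (norm_nonneg _), Lp.norm_toLp,
      ENNReal.ofReal_toReal (hX n).2.ne]
  simp_rw [h1]
  have := ENNReal.tendsto_ofReal ((Real.continuous_sqrt.tendsto _).comp h)
  simpa using this

end LTwo

/-! ### Density of step functions in `L²([0,1])`. -/

section StepApproximation

/-- The step function taking the left end values of `g` on a uniform grid of `[0, 1]`. -/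
noncomputable def gridStepFunction (g : ℝ → ℝ) (N : ℕ) : StepFunction where
  n := N
  time k := k / N
  time_mono := fun a b hab => by
    exact div_le_div_of_nonneg_right (Nat.cast_le.2 hab) zero_le
  coef k := g (k / N)

lemma exists_gridStepFunction_eq (g : ℝ → ℝ) {N : ℕ} (hN : 0 < N) {u : ℝ} (h0 : 0 < u) (h1 : u ≤ 1) :
    ∃ k < N, u ∈ Set.Ioc ((k : ℝ) / N) ((k + 1) / N) ∧ (gridStepFunction g N).toFun u = g (k / N) := by
  have hN' : (0 : ℝ) < N := by exact_mod_cast hN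
  -- Cells are open on the left, so the cell containing `u` has index `⌈N u⌉ - 1`.
  have hpos : 0 < ⌈(N : ℝ) * u⌉₊ := Nat.ceil_pos.2 (by positivity)
  obtain ⟨k, hk⟩ : ∃ k, ⌈(N : ℝ) * u⌉₊ = k + 1 := ⟨_, (Nat.succ_pred_eq_of_pos hpos).symm⟩
  have hk1 : (k : ℝ) < N * u := Nat.lt_ceil.1 (by omega)
  have hk2 : (N : ℝ) * u ≤ k + 1 := by
    have := Nat.le_ceil ((N : ℝ) * u)
    rw [hk] at this
    exact_mod_cast this
  have hkN : k < N := by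
    have : (k : ℝ) < N := by nlinarith
    exact_mod_cast this
  refine ⟨k, hkN, ⟨by rw [div_lt_iff₀ hN']; linarith, by rw [le_div_iff₀ hN']; linarith⟩, ?_⟩
  unfold StepFunction.toFun gridStepFunction
  simp only [NNReal.coe_div, NNReal.coe_natCast]
  rw [Finset.sum_eq_single k]
  · rw [Set.indicator_of_mem]
    push_cast
    exact ⟨by rw [div_lt_iff₀ hN']; linarith, by rw [le_div_iff₀ hN']; linarith⟩
  · intro l _ hl
    rw [Set.indicator_of_notMem]
    push_cast
    rintro ⟨h2, h3⟩
    rw [div_lt_iff₀ hN'] at h2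
    rw [le_div_iff₀ hN'] at h3
    rcases lt_or_gt_of_ne hl with h | h
    · have : (l : ℝ) + 1 ≤ k := by exact_mod_cast h
      linarith
    · have : (k : ℝ) + 1 ≤ l := by exact_mod_cast h
      linarith
  · intro h
    exact absurd (Finset.mem_range.2 hkN) h

/-- Bounded continuous functions are dense in `L²`, and uniform continuity on `[0,1]` makes a fine
grid approximate them uniformly. -/
lemma exists_stepFunction_eLpNorm_le {σ : ℝ → ℝ}
    (hσ : MemLp σ 2 (volume.restrict (Set.Icc (0 : ℝ) 1))) {ε : ℝ} (hε : 0 < ε) :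
    ∃ f : StepFunction, eLpNorm (fun u => f.toFun u - σ u) 2
      (volume.restrict (Set.Icc (0 : ℝ) 1)) ≤ ENNReal.ofReal ε := by
  obtain ⟨g, hg, gm⟩ := hσ.exists_boundedContinuous_eLpNorm_sub_le (by norm_num)
    (ε := ENNReal.ofReal (ε / 2)) (by simpa using hε)
  have huc : UniformContinuousOn g (Set.Icc (0 : ℝ) 1) :=
    isCompact_Icc.uniformContinuousOn_of_continuous g.continuous.continuousOn
  rw [Metric.uniformContinuousOn_iff] at huc
  obtain ⟨δ, hδ, huc⟩ := huc (ε / 2) (by positivity)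
  obtain ⟨N, hN⟩ := exists_nat_one_div_lt hδ
  have hN' : (0 : ℝ) < (N + 1 : ℕ) := by positivity
  set f := gridStepFunction g (N + 1) with hf
  have hfg : eLpNorm (fun u => f.toFun u - g u) 2 (volume.restrict (Set.Icc (0 : ℝ) 1)) ≤
      ENNReal.ofReal (ε / 2) := by
    have hb : ∀ᵐ u ∂(volume.restrict (Set.Icc (0 : ℝ) 1)), ‖f.toFun u - g u‖ ≤ ε / 2 := by
      -- The point `0` lies in no cell, so the uniform bound may fail there; it is a null set.
      rw [← restrict_Ioc_eq_restrict_Icc]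
      filter_upwards [ae_restrict_mem measurableSet_Ioc] with u hu
      obtain ⟨k, hk, ⟨h1, h2⟩, h3⟩ := exists_gridStepFunction_eq g (Nat.succ_pos N) hu.1 hu.2
      rw [hf, h3, ← dist_eq_norm]
      refine (huc _ ⟨by positivity, h1.le.trans hu.2⟩ _ ⟨hu.1.le, hu.2⟩ ?_).le
      rw [Real.dist_eq, abs_sub_comm, abs_of_nonneg (by linarith)]
      calc u - (k : ℝ) / (N + 1 : ℕ) ≤ ((k : ℝ) + 1) / (N + 1 : ℕ) - k / (N + 1 : ℕ) := by
            exact sub_le_sub_right h2 _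
        _ = 1 / ((N : ℝ) + 1) := by push_cast; ring
        _ < δ := hN
    simpa using eLpNorm_le_of_ae_bound (p := 2) hb
  refine ⟨f, ?_⟩
  have e : (fun u => f.toFun u - σ u) = (fun u => f.toFun u - g u) + (fun u => g u - σ u) := by
    ext u; simp
  rw [e]
  have m := f.memLp_toFun (volume.restrict (Set.Icc (0 : ℝ) 1))
  refine (eLpNorm_add_le (m.sub gm).1 (gm.sub hσ).1 (by norm_num)).trans ?_
  have hg' : eLpNorm (fun u => g u - σ u) 2 (volume.restrict (Set.Icc (0 : ℝ) 1)) ≤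
      ENNReal.ofReal (ε / 2) := by
    rw [show (fun u => g u - σ u) = ⇑g - σ from rfl, eLpNorm_sub_comm]
    exact hg
  refine (add_le_add hfg hg').trans ?_
  rw [← ENNReal.ofReal_add (by positivity) (by positivity), add_halves]

lemma memLp_two_of_bounded {σ : ℝ → ℝ} (hσ : Measurable σ)
    (h0 : ∀ t ∈ Set.Icc (0 : ℝ) 1, 0 ≤ σ t) (hb : ∃ C : ℝ, ∀ t ∈ Set.Icc (0 : ℝ) 1, σ t ≤ C) :
    MemLp σ 2 (volume.restrict (Set.Icc (0 : ℝ) 1)) :=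
  (memLp_two_iff_integrable_sq hσ.aestronglyMeasurable).2 (integrableOn_sq_of_bounded hσ h0 hb)

lemma exists_stepFunction_tendsto {σ : ℝ → ℝ}
    (hσ : MemLp σ 2 (volume.restrict (Set.Icc (0 : ℝ) 1))) :
    ∃ f : ℕ → StepFunction, Tendsto (fun n => eLpNorm (fun u => (f n).toFun u - σ u) 2
      (volume.restrict (Set.Icc (0 : ℝ) 1))) atTop (𝓝 0) := by
  choose f hf using fun n : ℕ => exists_stepFunction_eLpNorm_le hσ
    (ε := 1 / ((n : ℝ) + 1)) (by positivity)
  refine ⟨f, tendsto_of_tendsto_of_tendsto_of_le_of_le tendsto_const_nhds ?_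
    (fun _ => zero_le) hf⟩
  simpa using ENNReal.tendsto_ofReal (tendsto_one_div_add_atTop_nhds_zero_nat (𝕜 := ℝ))

end StepApproximation

/-! ### Construction of the integral and of its continuous version. -/

section Existence

variable {Ω : Type u} [MeasurableSpace Ω] {P : Measure Ω} {σ : ℝ → ℝ} {B : ℝ≥0 → Ω → ℝ}

/-- Integration up to time `t` is a contraction from `L²([0,1])` to `L²(P)`, so it preserves Cauchy
sequences. -/
lemma StepFunction.integral_sub_sq_le (f g : StepFunction) (hB : IsPreBrownianReal B P)
    (t : unitInterval) :
    ∫ ω, (f.integral B (unitInterval.toNNReal t) ω - g.integral B (unitInterval.toNNReal t) ω) ^ 2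
      ∂P ≤ ∫ u in Set.Icc (0 : ℝ) 1, (f.toFun u - g.toFun u) ^ 2 := by
  have e : ∫ ω, (f.integral B (unitInterval.toNNReal t) ω -
      g.integral B (unitInterval.toNNReal t) ω) ^ 2 ∂P =
      ∫ u in Set.Ioc (0 : ℝ) t, (f.toFun u - g.toFun u) ^ 2 := by
    simp_rw [sq]
    rw [FunctionalSV.integral_sub_mul_sub (f.memLp_integral hB _) (g.memLp_integral hB _)
      (f.memLp_integral hB _) (g.memLp_integral hB _),
      FunctionalSV.integral_sub_mul_sub (f.memLp_toFun _) (g.memLp_toFun _)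
      (f.memLp_toFun _) (g.memLp_toFun _)]
    simp_rw [StepFunction.integral_mul_integral _ _ hB, min_self, unitInterval.coe_toNNReal]
  rw [e]
  exact setIntegral_mono_set ((f.memLp_toFun _).sub (g.memLp_toFun _)).integrable_sq
    (Eventually.of_forall fun u => sq_nonneg _)
    (Set.Ioc_subset_Icc_self.trans (Set.Icc_subset_Icc_right t.2.2)).eventuallyLE

/-- The approximating sequence is prescribed: `exists_wienerFunctional` needs the same one for every
Brownian motion. -/
lemma exists_tendsto_integral {f : ℕ → StepFunction}
    (hσ : MemLp σ 2 (volume.restrict (Set.Icc (0 : ℝ) 1)))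
    (hf : Tendsto (fun n => eLpNorm (fun u => (f n).toFun u - σ u) 2
      (volume.restrict (Set.Icc (0 : ℝ) 1))) atTop (𝓝 0)) (hB : IsPreBrownianReal B P) :
    ∃ J : unitInterval → Ω → ℝ, (∀ t, Measurable (J t)) ∧
      ∀ t : unitInterval, Tendsto (fun n => eLpNorm
        (fun ω => (f n).integral B (unitInterval.toNNReal t) ω - J t ω) 2 P) atTop (𝓝 0) := by
  have mf := fun n => (f n).memLp_toFun (volume.restrict (Set.Icc (0 : ℝ) 1))
  have mI := fun n (t : unitInterval) => (f n).memLp_integral hB (unitInterval.toNNReal t)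
  have hc : CauchySeq fun n => (mf n).toLp (f n).toFun :=
    ((Lp.tendsto_Lp_iff_tendsto_eLpNorm'' _ mf σ hσ).2 hf).cauchySeq
  have hcI : ∀ t, ∃ Z : Lp ℝ 2 P, Tendsto (fun n => (mI n t).toLp _) atTop (𝓝 Z) := by
    intro t
    refine cauchySeq_tendsto_of_complete (Metric.cauchySeq_iff.2 fun ε hε => ?_)
    obtain ⟨N, hN⟩ := Metric.cauchySeq_iff.1 hc ε hε
    refine ⟨N, fun m hm n hn => lt_of_le_of_lt ?_ (hN m hm n hn)⟩
    refine (sq_le_sq₀ dist_nonneg dist_nonneg).1 ?_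
    rw [dist_toLp_sq, dist_toLp_sq]
    exact StepFunction.integral_sub_sq_le _ _ hB t
  choose Z hZ using hcI
  refine ⟨fun t => Z t, fun t => (Lp.stronglyMeasurable (Z t)).measurable, fun t => ?_⟩
  have := hZ t
  rw [← Lp.toLp_coeFn (Z t) (Lp.memLp (Z t))] at this
  exact (Lp.tendsto_Lp_iff_tendsto_eLpNorm'' _ (fun n => mI n t) _ (Lp.memLp (Z t))).1 this

lemma exists_isWienerIntegral
    (hσ : MemLp σ 2 (volume.restrict (Set.Icc (0 : ℝ) 1))) (hB : IsPreBrownianReal B P) :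
    ∃ J : unitInterval → Ω → ℝ, IsWienerIntegral σ B J P := by
  obtain ⟨f, hf⟩ := exists_stepFunction_tendsto hσ
  obtain ⟨J, hm, hJ⟩ := exists_tendsto_integral hσ hf hB
  exact ⟨J, hm, f, hf, hJ⟩

/-- The dyadic point `k / 2 ^ n`, truncated to the unit interval. -/
noncomputable def dyadicPoint (n k : ℕ) : unitInterval :=
  Set.projIcc 0 1 zero_le_one ((k : ℝ) / 2 ^ n)

lemma dyadicPoint_mono (n : ℕ) : Monotone (dyadicPoint n) := by
  intro a b hab
  refine Set.monotone_projIcc _ ?_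
  have : (a : ℝ) ≤ b := by exact_mod_cast hab
  gcongr

lemma dyadicPoint_succ_two_mul (n k : ℕ) : dyadicPoint (n + 1) (2 * k) = dyadicPoint n k := by
  unfold dyadicPoint
  congr 1
  push_cast
  rw [pow_succ]
  field_simp

lemma dyadicPoint_eq_one {n k : ℕ} (h : 2 ^ n ≤ k) : dyadicPoint n k = 1 := by
  refine Set.projIcc_of_right_le _ ?_
  rw [le_div_iff₀ (by positivity), one_mul]
  exact_mod_cast h

lemma dyadicPoint_sub_le (n k : ℕ) :
    (dyadicPoint n (k + 1) : ℝ) - dyadicPoint n k ≤ (1 / 2) ^ n := by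
  unfold dyadicPoint
  have hpos : (0 : ℝ) < 2 ^ n := by positivity
  have e : ((k + 1 : ℕ) : ℝ) / 2 ^ n = (k : ℝ) / 2 ^ n + (1 / 2) ^ n := by
    push_cast
    rw [one_div, inv_pow]
    field_simp
  have hp : (0 : ℝ) ≤ (1 / 2) ^ n := by positivity
  rw [e, Set.coe_projIcc, Set.coe_projIcc]
  grind

/-- The largest dyadic point of level `n` which is at most `t`. -/
noncomputable def dyadicFloor (n : ℕ) (t : unitInterval) : unitInterval :=
  dyadicPoint n ⌊(2 : ℝ) ^ n * t⌋₊

lemma coe_dyadicFloor (n : ℕ) (t : unitInterval) :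
    (dyadicFloor n t : ℝ) = ⌊(2 : ℝ) ^ n * t⌋₊ / 2 ^ n := by
  unfold dyadicFloor dyadicPoint
  have hpos : (0 : ℝ) < 2 ^ n := by positivity
  rw [Set.coe_projIcc, min_eq_right, max_eq_right]
  · positivity
  · rw [div_le_one hpos]
    refine (Nat.floor_le (mul_nonneg hpos.le t.2.1)).trans ?_
    exact mul_le_of_le_one_right hpos.le t.2.2

lemma dyadicFloor_le (n : ℕ) (t : unitInterval) : dyadicFloor n t ≤ t := by
  have hpos : (0 : ℝ) < 2 ^ n := by positivity
  rw [← Subtype.coe_le_coe, coe_dyadicFloor, div_le_iff₀ hpos, mul_comm (t : ℝ)]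
  exact Nat.floor_le (mul_nonneg hpos.le t.2.1)

lemma sub_dyadicFloor_le (n : ℕ) (t : unitInterval) : (t : ℝ) - dyadicFloor n t ≤ (1 / 2) ^ n := by
  have hpos : (0 : ℝ) < 2 ^ n := by positivity
  rw [coe_dyadicFloor, one_div, inv_pow]
  have h := Nat.lt_floor_add_one ((2 : ℝ) ^ n * t)
  have : (t : ℝ) < (⌊(2 : ℝ) ^ n * t⌋₊ + 1) / 2 ^ n := by
    rw [lt_div_iff₀ hpos]; linarith
  rw [add_div, one_div] at this
  linarith

lemma tendsto_dyadicFloor (t : unitInterval) :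
    Tendsto (fun n => dyadicFloor n t) atTop (𝓝 t) := by
  rw [tendsto_subtype_rng]
  have h : Tendsto (fun n : ℕ => (t : ℝ) - (1 / 2) ^ n) atTop (𝓝 t) := by
    simpa using (tendsto_pow_atTop_nhds_zero_of_lt_one (r := (1 / 2 : ℝ)) (by norm_num)
      (by norm_num)).const_sub (t : ℝ)
  refine tendsto_of_tendsto_of_tendsto_of_le_of_le h tendsto_const_nhds (fun n => ?_)
    (fun n => dyadicFloor_le n t)
  have := sub_dyadicFloor_le n t
  simp only
  linarith

/-- Chaining along dyadic points. -/
lemma exists_continuous_tendsto_dyadicFloor {x : unitInterval → ℝ} {S r : ℝ} (hr0 : 0 < r)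
    (hr1 : r < 1)
    (h : ∀ n k, |x (dyadicPoint n (k + 1)) - x (dyadicPoint n k)| ≤ S * r ^ n) :
    ∃ y : unitInterval → ℝ, Continuous y ∧
      ∀ t, Tendsto (fun n => x (dyadicFloor n t)) atTop (𝓝 (y t)) := by
  have hS : 0 ≤ S := by simpa using (abs_nonneg _).trans (h 0 0)
  have hdist : ∀ t n, dist (x (dyadicFloor n t)) (x (dyadicFloor (n + 1) t)) ≤ S * r ^ n := by
    intro t n
    -- Passing to level `n + 1` keeps the dyadic floor or moves it by one step of the finer grid, so
    -- one increment bounds the change.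
    have h2 : ⌊(2 : ℝ) ^ (n + 1) * t⌋₊ = 2 * ⌊(2 : ℝ) ^ n * t⌋₊ ∨
        ⌊(2 : ℝ) ^ (n + 1) * t⌋₊ = 2 * ⌊(2 : ℝ) ^ n * t⌋₊ + 1 := by
      have ht : (0 : ℝ) ≤ 2 ^ n * t := mul_nonneg (by positivity) t.2.1
      have e : (2 : ℝ) ^ (n + 1) * t = 2 * (2 ^ n * t) := by ring
      rw [e]
      have a1 := Nat.floor_le ht
      have a2 := Nat.lt_floor_add_one ((2 : ℝ) ^ n * t)
      have l1 : 2 * ⌊(2 : ℝ) ^ n * t⌋₊ ≤ ⌊2 * ((2 : ℝ) ^ n * t)⌋₊ := by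
        refine Nat.le_floor ?_
        push_cast
        linarith
      have l2 : ⌊2 * ((2 : ℝ) ^ n * t)⌋₊ < 2 * ⌊(2 : ℝ) ^ n * t⌋₊ + 2 := by
        refine (Nat.floor_lt (by positivity)).2 ?_
        push_cast
        linarith
      omega
    unfold dyadicFloor
    rcases h2 with h2 | h2
    · rw [h2, dyadicPoint_succ_two_mul, dist_self]
      positivity
    · rw [h2, dist_comm, Real.dist_eq, ← dyadicPoint_succ_two_mul n]
      refine (h _ _).trans (mul_le_mul_of_nonneg_left ?_ hS)
      exact pow_le_pow_of_le_one hr0.le hr1.le (Nat.le_succ n)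
  have hlim : ∀ t, ∃ z, Tendsto (fun n => x (dyadicFloor n t)) atTop (𝓝 z) := fun t =>
    cauchySeq_tendsto_of_complete (cauchySeq_of_le_geometric r S hr1 (hdist t))
  choose y hy using hlim
  refine ⟨y, ?_, hy⟩
  have hclose : ∀ t n, dist (x (dyadicFloor n t)) (y t) ≤ S * r ^ n / (1 - r) := fun t n =>
    dist_le_of_le_geometric_of_tendsto r S hr1 (hdist t) (hy t) n
  have hnear : ∀ n (s t : unitInterval), s ≤ t → (t : ℝ) - s < (1 / 2) ^ n →
      dist (x (dyadicFloor n s)) (x (dyadicFloor n t)) ≤ S * r ^ n := by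
    intro n s t hst hd
    have hpos : (0 : ℝ) < 2 ^ n := by positivity
    have hst' : (s : ℝ) ≤ t := hst
    have hd' : (2 : ℝ) ^ n * t < 2 ^ n * s + 1 := by
      have h1 := mul_lt_mul_of_pos_left hd hpos
      rw [← mul_pow, mul_sub] at h1
      norm_num at h1
      linarith
    -- Points closer than `2 ^ (-n)` have equal or adjacent floors.
    have h2 : ⌊(2 : ℝ) ^ n * t⌋₊ = ⌊(2 : ℝ) ^ n * s⌋₊ ∨
        ⌊(2 : ℝ) ^ n * t⌋₊ = ⌊(2 : ℝ) ^ n * s⌋₊ + 1 := by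
      have hs : (0 : ℝ) ≤ 2 ^ n * s := mul_nonneg hpos.le s.2.1
      have a2 := Nat.lt_floor_add_one ((2 : ℝ) ^ n * s)
      have l1 : ⌊(2 : ℝ) ^ n * s⌋₊ ≤ ⌊(2 : ℝ) ^ n * t⌋₊ :=
        Nat.floor_le_floor (mul_le_mul_of_nonneg_left hst' hpos.le)
      have l2 : ⌊(2 : ℝ) ^ n * t⌋₊ < ⌊(2 : ℝ) ^ n * s⌋₊ + 2 := by
        refine (Nat.floor_lt (mul_nonneg hpos.le t.2.1)).2 ?_
        push_cast
        linarith
      omega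
    unfold dyadicFloor
    rcases h2 with h2 | h2
    · rw [h2, dist_self]
      positivity
    · rw [h2, dist_comm, Real.dist_eq]
      exact h _ _
  have hmod : ∀ n (s t : unitInterval), s ≤ t → (t : ℝ) - s < (1 / 2) ^ n →
      dist (y s) (y t) ≤ (2 * S / (1 - r) + S) * r ^ n := by
    intro n s t hst hd
    have h1 := dist_triangle4 (y s) (x (dyadicFloor n s)) (x (dyadicFloor n t)) (y t)
    have h2 := hclose s n
    rw [dist_comm] at h2
    have h3 := hclose t n
    have h4 := hnear n s t hst hd
    calc dist (y s) (y t) ≤ S * r ^ n / (1 - r) + S * r ^ n + S * r ^ n / (1 - r) := by linarith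
      _ = _ := by ring
  rw [Metric.continuous_iff]
  intro t ε hε
  have ht : Tendsto (fun n : ℕ => (2 * S / (1 - r) + S) * r ^ n) atTop (𝓝 0) := by
    simpa using (tendsto_pow_atTop_nhds_zero_of_lt_one hr0.le hr1).const_mul
      (2 * S / (1 - r) + S)
  obtain ⟨n, hn⟩ := (ht.eventually (gt_mem_nhds hε)).exists
  refine ⟨(1 / 2) ^ n, by positivity, fun s hs => ?_⟩
  rw [Subtype.dist_eq, Real.dist_eq, abs_lt] at hs
  refine lt_of_le_of_lt ?_ hn
  rcases le_total s t with hst | hst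
  · exact hmod n s t hst (by linarith)
  · rw [dist_comm]
    exact hmod n t s hst (by linarith)

/-- Kolmogorov's argument with fourth moments, which are `O(4 ^ (-n))`. Weighted by `(10 / 9) ^ (4
n)` and summed over `2 ^ n` increments they give a geometric series of ratio `5000 / 6561`. The
weighted sum thus has finite mean and is a.s. finite. Any rate `r < 1` with `r ^ 4 > 1 / 2` would do
in place of `9 / 10`. -/
lemma IsWienerIntegral.ae_exists_increment_bound {J : unitInterval → Ω → ℝ}
    (hJ : IsWienerIntegral σ B J P) (hσ : Measurable σ)
    (h0 : ∀ t ∈ Set.Icc (0 : ℝ) 1, 0 ≤ σ t) (hb : ∃ C : ℝ, ∀ t ∈ Set.Icc (0 : ℝ) 1, σ t ≤ C)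
    (hB : IsPreBrownianReal B P) :
    ∀ᵐ ω ∂P, ∃ S : ℝ, ∀ n k,
      |J (dyadicPoint n (k + 1)) ω - J (dyadicPoint n k) ω| ≤ S * (9 / 10) ^ n := by
  have := hB.isGaussianProcess.isProbabilityMeasure
  have hi := integrableOn_sq_of_bounded hσ h0 hb
  obtain ⟨C, hC0, hC⟩ := exists_G_sub_le hσ h0 hb
  set K := normalFourthMoment * C ^ 2 with hK
  set F : ℕ → ℕ → Ω → ℝ≥0∞ := fun n k ω => ENNReal.ofReal
    ((10000 / 6561 : ℝ) ^ n * (J (dyadicPoint n (k + 1)) ω - J (dyadicPoint n k) ω) ^ 4) with hF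
  have mF : ∀ n k, Measurable (F n k) := fun n k =>
    ((((hJ.measurable _).sub (hJ.measurable _)).pow_const 4).const_mul _).ennreal_ofReal
  have hFk : ∀ n k, ∫⁻ ω, F n k ω ∂P ≤ ENNReal.ofReal (K * (2500 / 6561) ^ n) := by
    intro n k
    have hint : Integrable (fun ω => (J (dyadicPoint n (k + 1)) ω - J (dyadicPoint n k) ω) ^ 4) P := by
      refine (hJ.memLp_sub_sq hB (dyadicPoint n k) (dyadicPoint n (k + 1))).integrable_sq.congr
        (Eventually.of_forall fun ω => ?_)
      simp only
      ring
    rw [hF, ← ofReal_integral_eq_lintegral_ofReal (hint.const_mul _)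
      (Eventually.of_forall fun ω => by positivity), integral_const_mul,
      hJ.integral_sub_pow_four hσ hB (dyadicPoint_mono n (Nat.le_succ k))]
    refine ENNReal.ofReal_le_ofReal ?_
    have h1 := hC _ _ (dyadicPoint_mono n (Nat.le_succ k))
    have h2 : 0 ≤ G σ (dyadicPoint n (k + 1)) - G σ (dyadicPoint n k) :=
      sub_nonneg.2 (G_mono hi (dyadicPoint_mono n (Nat.le_succ k)))
    have h3 : G σ (dyadicPoint n (k + 1)) - G σ (dyadicPoint n k) ≤ C * (1 / 2) ^ n :=
      h1.trans (mul_le_mul_of_nonneg_left (dyadicPoint_sub_le n k) hC0)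
    have h4 := pow_le_pow_left₀ h2 h3 2
    calc (10000 / 6561 : ℝ) ^ n * (normalFourthMoment *
          (G σ (dyadicPoint n (k + 1)) - G σ (dyadicPoint n k)) ^ 2)
        ≤ (10000 / 6561 : ℝ) ^ n * (normalFourthMoment * (C * (1 / 2) ^ n) ^ 2) := by
          gcongr
          exact normalFourthMoment_nonneg
      _ = K * ((10000 / 6561) ^ n * ((1 / 2) ^ 2) ^ n) := by
          rw [hK, ← pow_mul, mul_comm 2 n, pow_mul]; ring
      _ = K * (2500 / 6561) ^ n := by rw [← mul_pow]; norm_num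
  have hsum : ∫⁻ ω, ∑' n, ∑ k ∈ Finset.range (2 ^ n), F n k ω ∂P ≠ ∞ := by
    rw [lintegral_tsum fun n => (Finset.measurable_sum _ fun k _ => mF n k).aemeasurable]
    have hle : ∀ n, ∫⁻ ω, ∑ k ∈ Finset.range (2 ^ n), F n k ω ∂P ≤
        ENNReal.ofReal (K * (5000 / 6561) ^ n) := by
      intro n
      rw [lintegral_finsetSum _ fun k _ => mF n k]
      refine (Finset.sum_le_sum fun k _ => hFk n k).trans (le_of_eq ?_)
      rw [Finset.sum_const, Finset.card_range, nsmul_eq_mul]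
      rw [show ((2 ^ n : ℕ) : ℝ≥0∞) = ENNReal.ofReal (2 ^ n) by
        rw [ENNReal.ofReal_pow (by norm_num)]; simp, ← ENNReal.ofReal_mul (by positivity)]
      congr 1
      rw [mul_left_comm, ← mul_pow]
      norm_num
    refine ne_top_of_le_ne_top ?_ (ENNReal.tsum_le_tsum hle)
    have hs : Summable fun n : ℕ => K * (5000 / 6561 : ℝ) ^ n :=
      (summable_geometric_of_lt_one (by norm_num) (by norm_num)).mul_left K
    exact hs.tsum_ofReal_ne_top
  filter_upwards [ae_lt_top (Measurable.tsum fun n =>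
    Finset.measurable_sum _ fun k _ => mF n k) hsum] with ω hω
  set T := (∑' n, ∑ k ∈ Finset.range (2 ^ n), F n k ω).toReal with hT
  have hT0 : 0 ≤ T := ENNReal.toReal_nonneg
  -- `T + 1` replaces the fourth root of `T`, since `T ≤ (T + 1) ^ 4`.
  refine ⟨T + 1, fun n k => ?_⟩
  rcases lt_or_ge k (2 ^ n) with hk | hk
  · have h1 : F n k ω ≤ ∑' n, ∑ k ∈ Finset.range (2 ^ n), F n k ω :=
      (Finset.single_le_sum (f := fun k => F n k ω) (fun _ _ => zero_le)
        (Finset.mem_range.2 hk)).trans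
        (ENNReal.le_tsum (f := fun n => ∑ k ∈ Finset.range (2 ^ n), F n k ω) n)
    have h2 := (ENNReal.ofReal_le_iff_le_toReal hω.ne).1 h1
    rw [← hT] at h2
    set d := J (dyadicPoint n (k + 1)) ω - J (dyadicPoint n k) ω with hd
    refine le_of_pow_le_pow_left₀ (n := 4) (by norm_num) (by positivity) ?_
    rw [Even.pow_abs (by decide), mul_pow, ← pow_mul, mul_comm n 4, pow_mul]
    have h3 : ((9 / 10 : ℝ) ^ 4) ^ n * (10000 / 6561) ^ n = 1 := by
      rw [← mul_pow]; norm_num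
    have h4 : d ^ 4 = ((9 / 10 : ℝ) ^ 4) ^ n * ((10000 / 6561) ^ n * d ^ 4) := by
      rw [← mul_assoc, h3, one_mul]
    have h5 : T ≤ (T + 1) ^ 4 := by
      nlinarith [sq_nonneg T, sq_nonneg (T ^ 2), pow_nonneg hT0 3, pow_nonneg hT0 4]
    rw [h4, mul_comm ((T + 1) ^ 4)]
    exact mul_le_mul_of_nonneg_left (h2.trans h5) (by positivity)
  · rw [dyadicPoint_eq_one hk, dyadicPoint_eq_one (hk.trans (Nat.le_succ k)), sub_self, abs_zero]
    positivity

/-- The Itô integral of a bounded measurable function has a continuous version. -/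
theorem exists_isItoIntegral (hσ : Measurable σ)
    (h0 : ∀ t ∈ Set.Icc (0 : ℝ) 1, 0 ≤ σ t) (hb : ∃ C : ℝ, ∀ t ∈ Set.Icc (0 : ℝ) 1, σ t ≤ C)
    (hB : IsPreBrownianReal B P) :
    ∃ J : unitInterval → Ω → ℝ, IsItoIntegral σ B J P := by
  have := hB.isGaussianProcess.isProbabilityMeasure
  have hi := integrableOn_sq_of_bounded hσ h0 hb
  obtain ⟨X, hX⟩ := exists_isWienerIntegral (memLp_two_of_bounded hσ h0 hb) hB
  have hlim : ∀ᵐ ω ∂P, ∃ y : unitInterval → ℝ, Continuous y ∧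
      ∀ t, Tendsto (fun n => X (dyadicFloor n t) ω) atTop (𝓝 (y t)) := by
    filter_upwards [hX.ae_exists_increment_bound hσ h0 hb hB] with ω ⟨S, hS⟩
    exact exists_continuous_tendsto_dyadicFloor (x := fun t => X t ω) (by norm_num) (by norm_num) hS
  -- A `limsup` is measurable in `ω` without removing the exceptional set.
  set J : unitInterval → Ω → ℝ := fun t ω => limsup (fun n => X (dyadicFloor n t) ω) atTop with hJ
  have hJlim : ∀ t, ∀ᵐ ω ∂P, Tendsto (fun n => X (dyadicFloor n t) ω) atTop (𝓝 (J t ω)) := by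
    intro t
    filter_upwards [hlim] with ω ⟨y, _, hy⟩
    rw [hJ]
    simp only
    rw [(hy t).limsup_eq]
    exact hy t
  -- Continuity of `G σ` makes `X` continuous in `L²`, so the pathwise dyadic limit agrees a.s. with
  -- `X t`.
  have hJX : ∀ t, J t =ᵐ[P] X t := by
    intro t
    have m := fun s => (hX.memLp hB t).sub (hX.memLp hB s)
    have h1 : Tendsto (fun n => ∫ ω, (X t ω - X (dyadicFloor n t) ω) ^ 2 ∂P) atTop (𝓝 0) := by
      simp_rw [fun n => hX.integral_sub_sq hσ hB (dyadicFloor_le n t)]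
      have := (((continuous_G hi).tendsto t).comp (tendsto_dyadicFloor t)).const_sub (G σ t)
      simpa using this
    have h2 := tendsto_eLpNorm_two_of_integral_sq (fun n => m (dyadicFloor n t)) h1
    have h3 : TendstoInMeasure P (fun n => X (dyadicFloor n t)) atTop (X t) := by
      refine tendstoInMeasure_of_tendsto_eLpNorm two_ne_zero (fun n => (hX.memLp hB _).1)
        (hX.memLp hB t).1 (h2.congr fun n => ?_)
      exact eLpNorm_sub_comm _ _ _ _
    have h4 := tendstoInMeasure_of_tendsto_ae
      (fun n => (hX.memLp hB (dyadicFloor n t)).1) (hJlim t)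
    exact tendstoInMeasure_ae_unique h4 h3
  refine ⟨J, fun t => Measurable.limsup fun n => hX.measurable _, ?_, ?_⟩
  · filter_upwards [hlim] with ω ⟨y, hc, hy⟩
    refine hc.congr fun t => ?_
    exact (hy t).limsup_eq.symm
  · obtain ⟨f, hf, hfX⟩ := hX.limit
    refine ⟨f, hf, fun t => (hfX t).congr fun n => eLpNorm_congr_ae ?_⟩
    filter_upwards [hJX t] with ω hω
    rw [hω]

/-- Equality a.s. at each time of a countable dense set extends to all times by path continuity. -/
lemma IsItoIntegral.ae_eq {J K : unitInterval → Ω → ℝ} (hJ : IsItoIntegral σ B J P)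
    (hK : IsItoIntegral σ B K P) (hσ : Measurable σ) (hB : IsPreBrownianReal B P) :
    ∀ᵐ ω ∂P, ∀ t, J t ω = K t ω := by
  have hd := TopologicalSpace.exists_countable_dense unitInterval
  obtain ⟨D, hDc, hD⟩ := hd
  have := (ae_ball_iff hDc).2 fun t (_ : t ∈ D) =>
    hJ.isWienerIntegral.ae_eq hK.isWienerIntegral hσ hB t
  filter_upwards [this, hJ.continuous, hK.continuous] with ω h1 h2 h3
  exact congrFun (Continuous.ext_on hD h2 h3 h1)

lemma IsItoIntegral.ae_eq_zero {J : unitInterval → Ω → ℝ} (hJ : IsItoIntegral σ B J P)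
    (hσ : Measurable σ) (hB : IsPreBrownianReal B P)
    (hG : ∀ t, G σ t = 0) : ∀ᵐ ω ∂P, ∀ t, J t ω = 0 := by
  obtain ⟨D, hDc, hD⟩ := TopologicalSpace.exists_countable_dense unitInterval
  have h0 : ∀ t, J t =ᵐ[P] 0 := fun t => by
    refine eLpNorm_two_eq_zero_of_integral_sq (hJ.isWienerIntegral.memLp hB t) ?_
    simp_rw [sq]
    rw [hJ.isWienerIntegral.integral_mul hJ.isWienerIntegral hσ hB, hG]
  filter_upwards [(ae_ball_iff hDc).2 fun t (_ : t ∈ D) => h0 t, hJ.continuous] with ω h1 h2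
  exact congrFun (Continuous.ext_on hD h2 continuous_const h1)

end Existence

/-! ### The AR(1) equation. -/

section Autoregression

/-- The moving average series `∑ φ ^ j e_{i-j}`, the causal solution of the AR(1) equation. -/
noncomputable def arSeries (φ : ℝ) (e : ℤ → ℝ) (i : ℤ) : ℝ := ∑' j : ℕ, φ ^ j * e (i - j)

lemma measurable_arSeries (φ : ℝ) : Measurable (arSeries φ) :=
  measurable_pi_lambda _ fun _ => Measurable.tsum fun _ => (measurable_pi_apply _).const_mul _

variable {Ω : Type u} [MeasurableSpace Ω] {P : Measure Ω} {φ : ℝ} {ε : ℤ → Ω → ℝ}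

lemma StrictlyStationary.identDistrib {S : Type v} [MeasurableSpace S] {X : ℤ → Ω → S}
    (h : StrictlyStationary X P) (i j : ℤ) : IdentDistrib (X i) (X j) P P := by
  have key : ∀ i, IdentDistrib (X i) (X 0) P P := fun i => by
    have := (h i).comp (measurable_pi_apply (0 : ℤ))
    simpa [Function.comp_def] using this
  exact (key i).trans (key j).symm

lemma strictlyStationary_of_iid {S : Type v} [MeasurableSpace S] {X : ℤ → Ω → S}
    (hind : iIndepFun X P) (hid : ∀ i j, IdentDistrib (X i) (X j) P P) :
    StrictlyStationary X P := fun h =>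
  IdentDistrib.pi (fun i => hid (i + h) i) (hind.precomp (add_left_injective h)) hind

/-- The moving average is measurable and commutes with shifts. -/
lemma StrictlyStationary.arSeries (h : StrictlyStationary ε P) (φ : ℝ) :
    StrictlyStationary (fun i ω => arSeries φ (fun k => ε k ω) i) P := fun s => by
  have := (h s).comp (measurable_arSeries φ)
  convert! this using 1
  ext ω i
  simp only [Function.comp_def, FunctionalSV.arSeries]
  refine tsum_congr fun j => ?_
  rw [show i + s - (j : ℤ) = i - j + s by ring]

/-- Geometric decay of the absolute means; it yields a.s. summability, integrability and termwise
expectation. -/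
lemma tsum_lintegral_arSeries_ne_top (hφ : |φ| < 1) (hint : ∀ i, Integrable (ε i) P)
    (hid : ∀ i j, IdentDistrib (ε i) (ε j) P P) (i : ℤ) :
    ∑' j : ℕ, ∫⁻ ω, ‖φ ^ j * ε (i - j) ω‖ₑ ∂P ≠ ∞ := by
  have e : ∀ j : ℕ, ∫⁻ ω, ‖φ ^ j * ε (i - j) ω‖ₑ ∂P =
      ENNReal.ofReal (|φ| ^ j) * ∫⁻ ω, ‖ε 0 ω‖ₑ ∂P := by
    intro j
    simp_rw [enorm_mul]
    have := ((hid (i - j) 0).comp measurable_enorm).lintegral_eq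
    simp only [Function.comp_def] at this
    rw [lintegral_const_mul' _ _ enorm_ne_top, this]
    congr 1
    rw [← ofReal_norm, norm_pow, Real.norm_eq_abs]
  simp_rw [e]
  rw [ENNReal.tsum_mul_right]
  refine ENNReal.mul_ne_top ?_ (hint 0).2.ne
  exact (summable_geometric_of_lt_one (abs_nonneg _) hφ).tsum_ofReal_ne_top

lemma ae_summable_arSeries (hφ : |φ| < 1) (hint : ∀ i, Integrable (ε i) P)
    (hid : ∀ i j, IdentDistrib (ε i) (ε j) P P) (i : ℤ) :
    ∀ᵐ ω ∂P, Summable fun j : ℕ => φ ^ j * ε (i - j) ω := by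
  have h := tsum_lintegral_arSeries_ne_top hφ hint hid i
  have m : ∀ j : ℕ, AEMeasurable (fun ω => ‖φ ^ j * ε (i - j) ω‖ₑ) P := fun j =>
    ((hint _).1.aemeasurable.const_mul _).enorm
  rw [← lintegral_tsum m] at h
  filter_upwards [ae_lt_top' (AEMeasurable.tsum m) h] with ω hω
  refine Summable.of_norm ?_
  exact (ENNReal.tsum_coe_ne_top_iff_summable_coe (f := fun j : ℕ => ‖φ ^ j * ε (i - j) ω‖₊)).1
    hω.ne

lemma integrable_arSeries (hφ : |φ| < 1) (hint : ∀ i, Integrable (ε i) P)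
    (hid : ∀ i j, IdentDistrib (ε i) (ε j) P P)
    (hm : ∀ i, Measurable (ε i)) (i : ℤ) :
    Integrable (fun ω => arSeries φ (fun k => ε k ω) i) P := by
  have h := tsum_lintegral_arSeries_ne_top hφ hint hid i
  have m : ∀ j : ℕ, AEMeasurable (fun ω => ‖φ ^ j * ε (i - j) ω‖ₑ) P := fun j =>
    ((hint _).1.aemeasurable.const_mul _).enorm
  refine ⟨((measurable_pi_apply i).comp ((measurable_arSeries φ).comp
    (measurable_pi_lambda _ hm))).aestronglyMeasurable, ?_⟩
  rw [← lintegral_tsum m] at h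
  refine (hasFiniteIntegral_def _ _).2 (lt_of_le_of_lt (lintegral_mono fun ω => ?_) h.lt_top)
  exact enorm_tsum_le_tsum_enorm

lemma integral_arSeries (hφ : |φ| < 1) (hint : ∀ i, Integrable (ε i) P)
    (hid : ∀ i j, IdentDistrib (ε i) (ε j) P P)
    (h0 : ∀ i, ∫ ω, ε i ω ∂P = 0) (i : ℤ) :
    ∫ ω, arSeries φ (fun k => ε k ω) i ∂P = 0 := by
  unfold arSeries
  rw [integral_tsum (fun j => (hint _).1.const_mul _)
    (tsum_lintegral_arSeries_ne_top hφ hint hid i)]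
  simp [integral_const_mul, h0]

lemma arSeries_ar (hφ : |φ| < 1) (hint : ∀ i, Integrable (ε i) P)
    (hid : ∀ i j, IdentDistrib (ε i) (ε j) P P) (i : ℤ) :
    ∀ᵐ ω ∂P, arSeries φ (fun k => ε k ω) i =
    φ * arSeries φ (fun k => ε k ω) (i - 1) + ε i ω := by
  filter_upwards [ae_summable_arSeries hφ hint hid i] with ω hω
  unfold arSeries
  rw [hω.tsum_eq_zero_add, ← tsum_mul_left, add_comm]
  congr 1
  · refine tsum_congr fun j => ?_
    rw [show i - ((j + 1 : ℕ) : ℤ) = i - 1 - j by push_cast; ring]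
    ring
  · simp

/-- Convergence in probability to a constant depends only on the laws, so each `Z k` may be replaced
by the fixed `Z'`. -/
lemma tendstoInMeasure_pow_mul [IsFiniteMeasure P] (hφ : |φ| < 1) {Z : ℕ → Ω → ℝ} {Z' : Ω → ℝ}
    (h : ∀ k, IdentDistrib (Z k) Z' P P) :
    TendstoInMeasure P (fun k ω => φ ^ k * Z k ω) atTop (fun _ => 0) := by
  have h0 : TendstoInMeasure P (fun k ω => φ ^ k * Z' ω) atTop (fun _ => 0) := by
    refine tendstoInMeasure_of_tendsto_ae
      (fun k => ((h 0).aemeasurable_snd.const_mul _).aestronglyMeasurable)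
      (Eventually.of_forall fun ω => ?_)
    simpa using (tendsto_pow_atTop_nhds_zero_of_abs_lt_one hφ).mul_const (Z' ω)
  rw [tendstoInMeasure_iff_dist] at h0 ⊢
  intro ε hε
  refine (h0 ε hε).congr fun k => ?_
  have ms : MeasurableSet {x : ℝ | ε ≤ dist (φ ^ k * x) 0} :=
    measurableSet_le measurable_const (by fun_prop)
  exact ((h k).measure_mem_eq ms).symm

/-- Two solutions of the AR(1) equation with constant one-dimensional laws coincide. -/
lemma ar_unique [IsFiniteMeasure P] (hφ : |φ| < 1) {L M : ℤ → Ω → ℝ}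
    (hL : ∀ i, ∀ᵐ ω ∂P, L i ω = φ * L (i - 1) ω + ε i ω)
    (hM : ∀ i, ∀ᵐ ω ∂P, M i ω = φ * M (i - 1) ω + ε i ω)
    (iL : ∀ i, IdentDistrib (L i) (L 0) P P) (iM : ∀ i, IdentDistrib (M i) (M 0) P P) (i : ℤ) :
    L i =ᵐ[P] M i := by
  -- Iterating both recursions cancels the innovations.
  have hD : ∀ k : ℕ, ∀ᵐ ω ∂P, L i ω - M i ω = φ ^ k * L (i - k) ω - φ ^ k * M (i - k) ω := by
    intro k
    induction k with
    | zero => simp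
    | succ k ih =>
      filter_upwards [ih, hL (i - k), hM (i - k)] with ω h1 h2 h3
      rw [h1, h2, h3, show i - ((k + 1 : ℕ) : ℤ) = i - k - 1 by push_cast; ring]
      ring
  -- Both terms tend to zero in probability; nested subsequences give a.e. convergence of both.
  obtain ⟨ns, hns, hL0⟩ := (tendstoInMeasure_pow_mul hφ
    (fun k : ℕ => iL (i - k))).exists_seq_tendsto_ae
  obtain ⟨ms, hms, hM0⟩ := ((tendstoInMeasure_pow_mul hφ
    (fun k : ℕ => iM (i - k))).comp hns.tendsto_atTop).exists_seq_tendsto_ae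
  filter_upwards [ae_all_iff.2 hD, hL0, hM0] with ω h1 h2 h3
  have h4 := (h2.comp hms.tendsto_atTop).sub h3
  have h5 : Tendsto (fun _ : ℕ => L i ω - M i ω) atTop (𝓝 (0 - 0)) :=
    h4.congr fun n => (h1 (ns (ms n))).symm
  rw [sub_zero] at h5
  exact sub_eq_zero.1 (tendsto_nhds_unique tendsto_const_nhds h5)

end Autoregression

/-! ### Measurable functionals and transfer between equal laws. -/

section Laws

/-- Limits in probability of measurable functionals of a random element are functionals of the
random element, the same for all random elements with the same law. -/
lemma exists_functional_of_tendstoInMeasure {Ω : Type u} [MeasurableSpace Ω] {P : Measure Ω}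
    [IsFiniteMeasure P] {S : Type*} [MeasurableSpace S] {U : ℕ → S → ℝ}
    (hU : ∀ n, Measurable (U n)) {X : Ω → S} {A : Ω → ℝ}
    (hA : TendstoInMeasure P (fun n ω => U n (X ω)) atTop A) :
    ∃ Ψ : S → ℝ, Measurable Ψ ∧ (∀ᵐ ω ∂P, A ω = Ψ (X ω)) ∧
      ∀ {Ω' : Type v} [MeasurableSpace Ω'] {P' : Measure Ω'} [IsFiniteMeasure P'] {X' : Ω' → S}
        {A' : Ω' → ℝ}, IdentDistrib X X' P P' →
        TendstoInMeasure P' (fun n ω => U n (X' ω)) atTop A' → ∀ᵐ ω ∂P', A' ω = Ψ (X' ω) := by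
  obtain ⟨ns, hns, hlim⟩ := hA.exists_seq_tendsto_ae
  have hm : Measurable fun x => limsup (fun n => U (ns n) x) atTop :=
    Measurable.limsup fun n => hU _
  refine ⟨fun x => limsup (fun n => U (ns n) x) atTop, hm, ?_, ?_⟩
  · filter_upwards [hlim] with ω hω
    exact hω.limsup_eq.symm
  · intro Ω' _ P' _ X' A' hX hA'
    -- The set of points where the subsequence converges is measurable in `S`, so its full measure
    -- carries over to `X'`.
    have h1 : ∀ᵐ ω ∂P, Tendsto (fun n => U (ns n) (X ω)) atTop
        (𝓝 (limsup (fun n => U (ns n) (X ω)) atTop)) := by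
      filter_upwards [hlim] with ω hω
      rwa [hω.limsup_eq]
    have h2 := hX.ae_snd (p := fun x => Tendsto (fun n => U (ns n) x) atTop
      (𝓝 (limsup (fun n => U (ns n) x) atTop))) (measurableSet_tendsto_fun (fun n => hU _) hm) h1
    have h3 := tendstoInMeasure_of_tendsto_ae
      (fun n => ((hU (ns n)).comp_aemeasurable hX.aemeasurable_snd).aestronglyMeasurable) h2
    exact tendstoInMeasure_ae_unique (hA'.comp hns.tendsto_atTop) h3

variable {Ω : Type u} [MeasurableSpace Ω] {P : Measure Ω}

lemma identDistrib_of_isPreBrownianReal {B B' : ℝ≥0 → Ω → ℝ} (hB : IsPreBrownianReal B P)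
    (hB' : IsPreBrownianReal B' P) (hm : ∀ t, Measurable (B t)) (hm' : ∀ t, Measurable (B' t)) :
    IdentDistrib (fun ω t => B t ω) (fun ω t => B' t ω) P P := by
  have := hB.isGaussianProcess.isProbabilityMeasure
  have m := (measurable_pi_lambda (fun ω t => B t ω) hm).aemeasurable (μ := P)
  have m' := (measurable_pi_lambda (fun ω t => B' t ω) hm').aemeasurable (μ := P)
  refine ⟨m, m', ?_⟩
  rw [map_eq_iff_forall_finset_map_restrict_eq m m']
  intro I
  rw [(hB.hasLaw I).map_eq, (hB'.hasLaw I).map_eq]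

/-- The Itô integral of `σ` is a measurable functional of the Brownian path. -/
lemma exists_wienerFunctional {ι : Type*} [Nonempty ι] {σ : ℝ → ℝ} (hσ : Measurable σ)
    (hσ2 : MemLp σ 2 (volume.restrict (Set.Icc (0 : ℝ) 1)))
    {W : ι → ℝ≥0 → Ω → ℝ} (hW : ∀ i, IsPreBrownianReal (W i) P) (hm : ∀ i t, Measurable (W i t)) :
    ∃ Φ : unitInterval → (ℝ≥0 → ℝ) → ℝ, (∀ t, Measurable (Φ t)) ∧
      ∀ i J, IsWienerIntegral σ (W i) J P → ∀ t, J t =ᵐ[P] fun ω => Φ t (fun s => W i s ω) := by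
  obtain ⟨k⟩ := ‹Nonempty ι›
  have hB := hW k
  have := hB.isGaussianProcess.isProbabilityMeasure
  obtain ⟨f, hf⟩ := exists_stepFunction_tendsto hσ2
  -- `J` may come with its own approximating sequence; a.s. uniqueness of the integral allows the
  -- common `f`.
  have hlim : ∀ i J, IsWienerIntegral σ (W i) J P → ∀ t : unitInterval, TendstoInMeasure P
      (fun n ω => (f n).integral (fun s (w : ℝ≥0 → ℝ) => w s) (unitInterval.toNNReal t)
        (fun s => W i s ω)) atTop (J t) := by
    intro i J hJ t
    obtain ⟨K, hKm, hK⟩ := exists_tendsto_integral hσ2 hf (hW i)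
    have hKJ := IsWienerIntegral.ae_eq ⟨hKm, f, hf, hK⟩ hJ hσ (hW i) t
    refine TendstoInMeasure.congr_right hKJ ?_
    exact tendstoInMeasure_of_tendsto_eLpNorm two_ne_zero
      (fun n => ((f n).memLp_integral (hW i) _).1) (hKm t).aestronglyMeasurable (hK t)
  obtain ⟨J₀, hJ₀⟩ := exists_isWienerIntegral hσ2 (hW k)
  have hU : ∀ (t : unitInterval) (n : ℕ), Measurable ((f n).integral
      (fun s (w : ℝ≥0 → ℝ) => w s) (unitInterval.toNNReal t)) := fun t n =>
    (f n).measurable_integral (fun s => measurable_pi_apply s) _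
  choose Φ hΦm _ hΦ using fun t =>
    exists_functional_of_tendstoInMeasure.{u, u} (hU t) (hlim k J₀ hJ₀ t)
  refine ⟨Φ, hΦm, fun i J hJ t => ?_⟩
  exact hΦ t (identDistrib_of_isPreBrownianReal (hW k) (hW i) (hm k) (hm i)) (hlim i J hJ t)

/-- If the scaling factors are strictly stationary, so are the curves. -/
lemma strictlyStationary_curves [IsProbabilityMeasure P] {σ : ℝ → ℝ} (hσ : Measurable σ)
    (hσ2 : MemLp σ 2 (volume.restrict (Set.Icc (0 : ℝ) 1)))
    {W : ℤ → ℝ≥0 → Ω → ℝ} (hW : ∀ i, IsPreBrownianReal (W i) P) (hm : ∀ i t, Measurable (W i t))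
    (hind : iIndepFun (fun i ω t => W i t ω) P) {g : ℤ → Ω → ℝ} (hg : ∀ i, Measurable (g i))
    (hgs : StrictlyStationary g P)
    (hgW : IndepFun (fun ω i t => W i t ω) (fun ω i => g i ω) P)
    {R J : ℤ → unitInterval → Ω → ℝ} (hJ : ∀ i, IsWienerIntegral σ (W i) (J i) P)
    (hR : ∀ i t, Measurable (R i t)) (hRJ : ∀ i t, ∀ᵐ ω ∂P, R i t ω = g i ω * J i t ω) :
    StrictlyStationary (fun i ω t => R i t ω) P := by
  intro h
  obtain ⟨Φ, hΦm, hΦ⟩ := exists_wienerFunctional hσ hσ2 hW hm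
  have mW : Measurable fun ω i t => W i t ω :=
    measurable_pi_lambda _ fun i => measurable_pi_lambda _ fun t => hm i t
  have mg : Measurable fun ω i => g i ω := measurable_pi_lambda _ hg
  have hWs : StrictlyStationary (fun i ω t => W i t ω) P := strictlyStationary_of_iid hind
    fun i j => identDistrib_of_isPreBrownianReal (hW i) (hW j) (hm i) (hm j)
  have hshift : Measurable fun (w : ℤ → ℝ≥0 → ℝ) i => w (i + h) :=
    measurable_pi_lambda _ fun i => measurable_pi_apply _
  have hshift' : Measurable fun (x : ℤ → ℝ) i => x (i + h) :=
    measurable_pi_lambda _ fun i => measurable_pi_apply _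
  have hpair := (hWs h).prodMk (hgs h) (hgW.comp hshift hshift') hgW
  -- All curves are one fixed function of the Brownian motions and factors, whose joint law is shift
  -- invariant by independence.
  let T : (ℤ → ℝ≥0 → ℝ) × (ℤ → ℝ) → ℤ × unitInterval → ℝ := fun x p => x.2 p.1 * Φ p.2 (x.1 p.1)
  have mT : Measurable T := measurable_pi_lambda _ fun p =>
    ((measurable_pi_apply p.1).comp measurable_snd).mul
      ((hΦm p.2).comp ((measurable_pi_apply p.1).comp measurable_fst))
  let D : (ℤ × unitInterval → ℝ) → ℤ → unitInterval → ℝ := fun x i t => x (i, t)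
  have mD : Measurable D := measurable_pi_lambda _ fun i => measurable_pi_lambda _ fun t =>
    measurable_pi_apply _
  -- With the double index flattened, a.e. equality of each coordinate separately determines the law
  -- on the product, although there are uncountably many coordinates.
  have hT : ∀ s : ℤ, IdentDistrib (fun ω (p : ℤ × unitInterval) => R (p.1 + s) p.2 ω)
      (fun ω => T (fun i t => W (i + s) t ω, fun i => g (i + s) ω)) P P := by
    intro s
    have m1 : Measurable fun ω (p : ℤ × unitInterval) => R (p.1 + s) p.2 ω :=
      measurable_pi_lambda _ fun p => hR _ _
    have m2 : Measurable fun ω => T (fun i t => W (i + s) t ω, fun i => g (i + s) ω) :=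
      mT.comp ((measurable_pi_lambda _ fun i => measurable_pi_lambda _ fun t => hm _ t).prodMk
        (measurable_pi_lambda _ fun i => hg _))
    refine ⟨m1.aemeasurable, m2.aemeasurable,
      map_eq_of_forall_ae_eq m1.aemeasurable m2.aemeasurable fun p => ?_⟩
    filter_upwards [hRJ (p.1 + s) p.2, hΦ (p.1 + s) _ (hJ _) p.2] with ω h1 h2
    simp only [h1, h2]
  have h0 := hT 0
  simp only [add_zero] at h0
  exact (((hT h).trans (hpair.comp mT)).trans h0.symm).comp mD

end Laws

/-! ### Quadratic variation along dyadic partitions, as a limit of functionals of the path. -/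

section DyadicVariation

/-- The dyadic partition points of level `n`, stopped at `t`. -/
noncomputable def stoppedDyadic (t : unitInterval) (n k : ℕ) : unitInterval :=
  min (dyadicPoint n k) t

lemma stoppedDyadic_mono (t : unitInterval) (n : ℕ) : Monotone (stoppedDyadic t n) :=
  fun _ _ h => min_le_min_right _ (dyadicPoint_mono n h)

lemma stoppedDyadic_zero (t : unitInterval) (n : ℕ) : stoppedDyadic t n 0 = 0 := by
  have : dyadicPoint n 0 = 0 := by
    unfold dyadicPoint
    simp
  rw [stoppedDyadic, this]
  exact min_eq_left t.2.1

lemma stoppedDyadic_end (t : unitInterval) (n : ℕ) : stoppedDyadic t n (2 ^ n) = t := by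
  rw [stoppedDyadic, dyadicPoint_eq_one le_rfl]
  exact min_eq_right t.2.2

lemma stoppedDyadic_mesh (t : unitInterval) (δ : ℝ) (hδ : 0 < δ) : ∀ᶠ n in atTop, ∀ k < 2 ^ n,
    (stoppedDyadic t n (k + 1) : ℝ) - (stoppedDyadic t n k : ℝ) < δ := by
  have h := tendsto_pow_atTop_nhds_zero_of_lt_one (r := (1 / 2 : ℝ)) (by norm_num) (by norm_num)
  filter_upwards [h.eventually (gt_mem_nhds hδ)] with n hn k _
  refine lt_of_le_of_lt ?_ hn
  have h1 := dyadicPoint_sub_le n k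
  have h2 : (dyadicPoint n k : ℝ) ≤ dyadicPoint n (k + 1) := dyadicPoint_mono n (Nat.le_succ k)
  have h3 : (0 : ℝ) ≤ (1 / 2) ^ n := by positivity
  unfold stoppedDyadic
  have e : ∀ a b : unitInterval, ((min a b : unitInterval) : ℝ) = min (a : ℝ) b :=
    fun a b => (Subtype.mono_coe (· ∈ unitInterval)).map_min
  rw [e, e]
  grind

/-- The sum of squared increments of a curve along the dyadic partition of `[0, t]`. -/
noncomputable def dyadicVariation (t : unitInterval) (n : ℕ) (x : unitInterval → ℝ) : ℝ :=
  ∑ k ∈ Finset.range (2 ^ n), (x (stoppedDyadic t n (k + 1)) - x (stoppedDyadic t n k)) ^ 2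

lemma measurable_dyadicVariation (t : unitInterval) (n : ℕ) : Measurable (dyadicVariation t n) := by
  unfold dyadicVariation
  fun_prop

variable {Ω : Type u} [MeasurableSpace Ω] {P : Measure Ω}

lemma IsQuadraticVariation.tendstoInMeasure_dyadicVariation {X Q : unitInterval → Ω → ℝ}
    (h : IsQuadraticVariation X Q P) (t : unitInterval) :
    TendstoInMeasure P (fun n ω => dyadicVariation t n (fun s => X s ω)) atTop (Q t) :=
  h.limit t (fun n => 2 ^ n) (stoppedDyadic t) (stoppedDyadic_mono t) (stoppedDyadic_zero t)
    (stoppedDyadic_end t) (stoppedDyadic_mesh t)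

lemma IsQuadraticVariation.ae_eq {X Q Q' : unitInterval → Ω → ℝ}
    (h : IsQuadraticVariation X Q P) (h' : IsQuadraticVariation X Q' P) (t : unitInterval) :
    Q t =ᵐ[P] Q' t :=
  tendstoInMeasure_ae_unique (h.tendstoInMeasure_dyadicVariation t)
    (h'.tendstoInMeasure_dyadicVariation t)

end DyadicVariation

/-! ### Solutions: quadratic variation, uniqueness and existence. -/

section Solutions

variable {Ω : Type u} [MeasurableSpace Ω] {P : Measure Ω}
  {σ : ℝ → ℝ} {φ : ℝ} {ε : ℤ → Ω → ℝ} {W : ℤ → ℝ≥0 → Ω → ℝ} {g : ℤ → Ω → ℝ}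
  {R : ℤ → unitInterval → Ω → ℝ}

lemma Conditions.integrableOn_sq (hc : Conditions σ φ ε W P) :
    IntegrableOn (fun u => σ u ^ 2) (Set.Icc 0 1) :=
  integrableOn_sq_of_bounded hc.sigma_measurable hc.sigma_nonneg hc.sigma_bounded

lemma Conditions.isPreBrownianReal (hc : Conditions σ φ ε W P) (i : ℤ) :
    IsPreBrownianReal (W i) P := (hc.W_brownian i).toIsPreBrownianReal

lemma Conditions.strictlyStationary_arSeries (hc : Conditions σ φ ε W P) :
    StrictlyStationary (fun i ω => arSeries φ (fun k => ε k ω) i) P :=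
  (strictlyStationary_of_iid hc.eps_indep hc.eps_identDistrib).arSeries φ

lemma IsSolution.log_mul_G (hs : IsSolution σ φ ε W g R P) {t : unitInterval}
    (ht : 0 < G σ t) (i : ℤ) :
    ∀ᵐ ω ∂P, Real.log (g i ω ^ 2 * G σ t) = 2 * Real.log (g i ω) + H σ t := by
  filter_upwards [hs.g_pos i] with ω hω
  rw [Real.log_mul (by positivity) ht.ne', Real.log_pow, H]
  norm_num

lemma IsSolution.ae_eq_of_log_ae_eq {g' : ℤ → Ω → ℝ} {R' : ℤ → unitInterval → Ω → ℝ}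
    (hs : IsSolution σ φ ε W g R P) (hs' : IsSolution σ φ ε W g' R' P) {i : ℤ}
    (h : (fun ω => Real.log (g' i ω)) =ᵐ[P] fun ω => Real.log (g i ω)) : g' i =ᵐ[P] g i := by
  filter_upwards [h, hs.g_pos i, hs'.g_pos i] with ω h1 h2 h3
  exact Real.log_injOn_pos h3 h2 h1

lemma IsSolution.curve_ae_eq {g' : ℤ → Ω → ℝ} {R' : ℤ → unitInterval → Ω → ℝ}
    (hs : IsSolution σ φ ε W g R P) (hs' : IsSolution σ φ ε W g' R' P)
    (hc : Conditions σ φ ε W P) {i : ℤ} (hg : g' i =ᵐ[P] g i) :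
    ∀ᵐ ω ∂P, ∀ t, R' i t ω = R i t ω := by
  obtain ⟨J, hJ, hRJ⟩ := hs.R_eq i
  obtain ⟨J', hJ', hRJ'⟩ := hs'.R_eq i
  filter_upwards [hRJ, hRJ', hg, hJ.ae_eq hJ' hc.sigma_measurable (hc.isPreBrownianReal i)]
    with ω h1 h2 h3 h4 t
  rw [h1, h2, h3, h4]

lemma IsSolution.curve_ae_eq_zero (hs : IsSolution σ φ ε W g R P) (hc : Conditions σ φ ε W P)
    (hG : ∀ t, G σ t = 0) (i : ℤ) : ∀ᵐ ω ∂P, ∀ t, R i t ω = 0 := by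
  obtain ⟨J, hJ, hRJ⟩ := hs.R_eq i
  filter_upwards [hRJ, hJ.ae_eq_zero hc.sigma_measurable (hc.isPreBrownianReal i) hG]
    with ω h1 h2 t
  rw [h1, h2, mul_zero]

variable [IsProbabilityMeasure P]

lemma Conditions.integrable_eps (hc : Conditions σ φ ε W P) (i : ℤ) : Integrable (ε i) P :=
  (hc.eps_memLp i).integrable (by norm_num)

/-- The factor `g i` does not depend on time, so its square comes out of every sum. -/
lemma IsSolution.isQuadraticVariation (hs : IsSolution σ φ ε W g R P)
    (hc : Conditions σ φ ε W P) (i : ℤ) :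
    IsQuadraticVariation (R i) (fun t ω => g i ω ^ 2 * G σ t) P where
  measurable t := ((hs.g_measurable i).pow_const 2).mul_const _
  zero := Eventually.of_forall fun ω => by simp [G_zero]
  continuous := Eventually.of_forall fun ω => continuous_const.mul (continuous_G hc.integrableOn_sq)
  monotone := Eventually.of_forall fun ω _ _ hst =>
    mul_le_mul_of_nonneg_left (G_mono hc.integrableOn_sq hst) (sq_nonneg _)
  limit t N τ hmono hzero hend hmesh := by
    obtain ⟨J, hJ, hRJ⟩ := hs.R_eq i
    have h1 := hJ.isWienerIntegral.tendstoInMeasure_sum_sq_increments hc.sigma_measurable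
      hc.sigma_nonneg hc.sigma_bounded (hc.isPreBrownianReal i) t N τ hmono hzero hend hmesh
    have h2 := TendstoInMeasure.mul_left (fun n => (Finset.measurable_sum _ fun k _ =>
      ((hJ.measurable _).sub (hJ.measurable _)).pow_const 2).aestronglyMeasurable)
      ((hs.g_measurable i).pow_const 2).aestronglyMeasurable h1
    refine TendstoInMeasure.congr_left (fun n => ?_) h2
    filter_upwards [hRJ] with ω hω
    rw [Finset.mul_sum]
    exact Finset.sum_congr rfl fun k _ => by rw [hω, hω, Pi.sub_apply]; ring

lemma IsSolution.log_eq_of_identDistrib (hs : IsSolution σ φ ε W g R P)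
    (hc : Conditions σ φ ε W P)
    (h : ∀ i, IdentDistrib (fun ω => Real.log (g i ω)) (fun ω => Real.log (g 0 ω)) P P) (i : ℤ) :
    (fun ω => Real.log (g i ω)) =ᵐ[P] fun ω => arSeries φ (fun k => ε k ω) i :=
  ar_unique hc.phi_lt_one hs.ar
    (arSeries_ar hc.phi_lt_one hc.integrable_eps hc.eps_identDistrib) h
    (fun i => hc.strictlyStationary_arSeries.identDistrib i 0) i

/-- Strict stationarity of the curves pins down the scaling factors. -/
lemma IsSolution.log_eq_of_strictlyStationary (hs : IsSolution σ φ ε W g R P)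
    (hc : Conditions σ φ ε W P) (hR : StrictlyStationary (fun i ω t => R i t ω) P)
    {t : unitInterval} (ht : 0 < G σ t) (i : ℤ) :
    (fun ω => Real.log (g i ω)) =ᵐ[P] fun ω => arSeries φ (fun k => ε k ω) i := by
  refine hs.log_eq_of_identDistrib hc (fun i => ?_) i
  have hq := fun i => (hs.isQuadraticVariation hc i).tendstoInMeasure_dyadicVariation t
  -- The functional found for the curve `R 0` serves every `R i`, since all have the same law.
  obtain ⟨Ψ, hΨm, hΨ0, hΨ⟩ := exists_functional_of_tendstoInMeasure.{u, u}
    (measurable_dyadicVariation t) (hq 0)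
  have hid := hR.identDistrib i 0
  have e : ∀ i, (∀ᵐ ω ∂P, g i ω ^ 2 * G σ t = Ψ (fun s => R i s ω)) →
      (fun ω => (Real.log (Ψ (fun s => R i s ω)) - H σ t) / 2) =ᵐ[P]
        fun ω => Real.log (g i ω) := by
    intro i h
    filter_upwards [h, hs.log_mul_G ht i] with ω h1 h2
    rw [← h1, h2]
    ring
  have mF : Measurable fun x : unitInterval → ℝ => (Real.log (Ψ x) - H σ t) / 2 :=
    (hΨm.log.sub_const _).div_const _
  have a : ∀ i, AEMeasurable (fun ω => (Real.log (Ψ (fun s => R i s ω)) - H σ t) / 2) P :=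
    fun i => (mF.comp (measurable_pi_lambda _ fun s => hs.R_measurable i s)).aemeasurable
  have hi := IdentDistrib.of_ae_eq (a i) (e i (hΨ hid.symm (hq i)))
  have h0 := IdentDistrib.of_ae_eq (a 0) (e 0 hΨ0)
  exact (hi.symm.trans (hid.comp mF)).trans h0

lemma IsSolution.integrable_log (hs : IsSolution σ φ ε W g R P)
    (hc : Conditions σ φ ε W P) (hR : StrictlyStationary (fun i ω t => R i t ω) P)
    {t : unitInterval} (ht : 0 < G σ t) (i : ℤ) :
    Integrable (fun ω => Real.log (g i ω)) P :=
  (integrable_arSeries hc.phi_lt_one hc.integrable_eps hc.eps_identDistrib hc.eps_measurable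
    i).congr (hs.log_eq_of_strictlyStationary hc hR ht i).symm

lemma IsSolution.integral_log (hs : IsSolution σ φ ε W g R P)
    (hc : Conditions σ φ ε W P) (hR : StrictlyStationary (fun i ω t => R i t ω) P)
    {t : unitInterval} (ht : 0 < G σ t) (i : ℤ) :
    ∫ ω, Real.log (g i ω) ∂P = 0 := by
  rw [integral_congr_ae (hs.log_eq_of_strictlyStationary hc hR ht i)]
  exact integral_arSeries hc.phi_lt_one hc.integrable_eps hc.eps_identDistrib hc.eps_mean i

lemma IsSolution.log_quadraticVariation (hs : IsSolution σ φ ε W g R P)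
    (hc : Conditions σ φ ε W P) (hR : StrictlyStationary (fun i ω t => R i t ω) P) {i : ℤ}
    {Q : unitInterval → Ω → ℝ} (hQ : IsQuadraticVariation (R i) Q P)
    {t : unitInterval} (ht : 0 < G σ t) :
    (∀ᵐ ω ∂P, Real.log (Q t ω) = 2 * Real.log (g i ω) + H σ t) ∧
      Integrable (fun ω => Real.log (Q t ω)) P ∧ ∫ ω, Real.log (Q t ω) ∂P = H σ t := by
  have h1 : ∀ᵐ ω ∂P, Real.log (Q t ω) = 2 * Real.log (g i ω) + H σ t := by
    filter_upwards [hQ.ae_eq (hs.isQuadraticVariation hc i) t, hs.log_mul_G ht i] with ω h1 h2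
    rw [h1, h2]
  have hi := (hs.integrable_log hc hR ht i).const_mul 2
  refine ⟨h1, (hi.add (integrable_const (H σ t))).congr ?_, ?_⟩
  · filter_upwards [h1] with ω hω using hω.symm
  · rw [integral_congr_ae h1, integral_add hi (integrable_const _), integral_const_mul,
      hs.integral_log hc hR ht i]
    simp

/-- Existence of the strictly stationary solution. -/
lemma Conditions.exists_solution (hc : Conditions σ φ ε W P) :
    ∃ (g : ℤ → Ω → ℝ) (R : ℤ → unitInterval → Ω → ℝ), IsSolution σ φ ε W g R P ∧
      StrictlyStationary (fun i ω => Real.log (g i ω)) P ∧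
      StrictlyStationary (fun i ω t => R i t ω) P := by
  set Y : ℤ → Ω → ℝ := fun i ω => arSeries φ (fun k => ε k ω) i with hY
  have hYs : StrictlyStationary Y P := hc.strictlyStationary_arSeries
  have mAr : ∀ i, Measurable fun e => arSeries φ e i := fun i =>
    (measurable_pi_apply i).comp (measurable_arSeries φ)
  have mY : ∀ i, Measurable (Y i) := fun i =>
    (mAr i).comp (measurable_pi_lambda _ hc.eps_measurable)
  choose J hJ using fun i => exists_isItoIntegral hc.sigma_measurable hc.sigma_nonneg
    hc.sigma_bounded (hc.isPreBrownianReal i)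
  have mExp : Measurable fun (x : ℤ → ℝ) i => Real.exp (x i) :=
    measurable_pi_lambda _ fun i => (measurable_pi_apply i).exp
  have hgW : IndepFun (fun ω i t => W i t ω) (fun ω i => Real.exp (Y i ω)) P :=
    hc.W_indep_eps.comp (φ := id) (ψ := fun e i => Real.exp (arSeries φ e i)) measurable_id
      (measurable_pi_lambda _ fun i => (mAr i).exp)
  have hgm : ∀ i, Measurable fun ω => Real.exp (Y i ω) := fun i => (mY i).exp
  refine ⟨fun i ω => Real.exp (Y i ω), fun i t ω => Real.exp (Y i ω) * J i t ω,
    ⟨hgm, fun i => Eventually.of_forall fun ω => Real.exp_pos _, hgW, fun i => ?_,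
      fun i t => (hgm i).mul ((hJ i).measurable t),
      fun i => ⟨J i, hJ i, Eventually.of_forall fun ω t => rfl⟩⟩, ?_, ?_⟩
  · simp only [Real.log_exp]
    exact arSeries_ar hc.phi_lt_one hc.integrable_eps hc.eps_identDistrib i
  · simpa only [Real.log_exp] using hYs
  · exact strictlyStationary_curves hc.sigma_measurable
      (memLp_two_of_bounded hc.sigma_measurable hc.sigma_nonneg hc.sigma_bounded)
      hc.isPreBrownianReal hc.W_measurable hc.W_indep hgm (fun h => (hYs h).comp mExp) hgW
      (fun i => (hJ i).isWienerIntegral) (fun i t => (hgm i).mul ((hJ i).measurable t))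
      (fun i t => Eventually.of_forall fun ω => rfl)

end Solutions

/-! ### Identifiability from the law of one curve. -/

section Identifiability

/-- Equality of the cumulative volatilities forces equality of the volatilities. -/
lemma ae_eq_of_G_eq {σ σ' : ℝ → ℝ} (hσ : Measurable σ) (hσ' : Measurable σ')
    (h0 : ∀ t ∈ Set.Icc (0 : ℝ) 1, 0 ≤ σ t) (h0' : ∀ t ∈ Set.Icc (0 : ℝ) 1, 0 ≤ σ' t)
    (hi : IntegrableOn (fun u => σ u ^ 2) (Set.Icc 0 1))
    (hi' : IntegrableOn (fun u => σ' u ^ 2) (Set.Icc 0 1)) (h : ∀ t, G σ t = G σ' t) :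
    σ =ᵐ[volume.restrict (Set.Icc (0 : ℝ) 1)] σ' := by
  rw [← restrict_Ioc_eq_restrict_Icc]
  set μ := volume.restrict (Set.Ioc (0 : ℝ) 1) with hμ
  -- `G τ`, extended by constants outside `[0,1]`, is the distribution function of the measure with
  -- density `τ ^ 2`.
  have hIoc : ∀ (τ : ℝ → ℝ), IntegrableOn (fun u => τ u ^ 2) (Set.Icc 0 1) → ∀ a : ℝ,
      (μ.withDensity fun u => ENNReal.ofReal (τ u ^ 2)) (Set.Iic a) =
        ENNReal.ofReal (G τ (Set.projIcc 0 1 zero_le_one a)) := by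
    intro τ hτ a
    have hs : Set.Iic a ∩ Set.Ioc (0 : ℝ) 1 =
        Set.Ioc (0 : ℝ) ((Set.projIcc (0 : ℝ) 1 zero_le_one a : unitInterval) : ℝ) := by
      ext u
      simp only [Set.coe_projIcc, Set.mem_inter_iff, Set.mem_Iic, Set.mem_Ioc]
      grind
    rw [withDensity_apply _ measurableSet_Iic, hμ, Measure.restrict_restrict measurableSet_Iic, hs,
      G, intervalIntegral.integral_of_le (Set.projIcc (0 : ℝ) 1 zero_le_one a).2.1,
      ofReal_integral_eq_lintegral_ofReal _ (Eventually.of_forall fun u => sq_nonneg _)]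
    exact hτ.mono_set (Set.Ioc_subset_Icc_self.trans
      (Set.Icc_subset_Icc_right (Set.projIcc (0 : ℝ) 1 zero_le_one a).2.2))
  have hfin : ∫⁻ u, ENNReal.ofReal (σ u ^ 2) ∂μ ≠ ∞ := by
    rw [← ofReal_integral_eq_lintegral_ofReal (hi.mono_set Set.Ioc_subset_Icc_self)
      (Eventually.of_forall fun u => sq_nonneg _)]
    exact ENNReal.ofReal_ne_top
  have : IsFiniteMeasure (μ.withDensity fun u => ENNReal.ofReal (σ u ^ 2)) :=
    isFiniteMeasure_withDensity hfin
  have hm : (μ.withDensity fun u => ENNReal.ofReal (σ u ^ 2)) =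
      μ.withDensity fun u => ENNReal.ofReal (σ' u ^ 2) :=
    Measure.ext_of_Iic _ _ fun a => by rw [hIoc σ hi, hIoc σ' hi', h]
  rw [withDensity_eq_iff (hσ.pow_const 2).ennreal_ofReal.aemeasurable
    (hσ'.pow_const 2).ennreal_ofReal.aemeasurable hfin] at hm
  filter_upwards [hm, ae_restrict_mem measurableSet_Ioc] with u hu hmem
  rw [ENNReal.ofReal_eq_ofReal_iff (sq_nonneg _) (sq_nonneg _)] at hu
  exact (sq_eq_sq₀ (h0 u (Set.Ioc_subset_Icc_self hmem)) (h0' u (Set.Ioc_subset_Icc_self hmem))).1 hu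

variable {Ω : Type u} [MeasurableSpace Ω] {P : Measure Ω} [IsProbabilityMeasure P]
  {σ : ℝ → ℝ} {φ : ℝ} {ε : ℤ → Ω → ℝ} {W : ℤ → ℝ≥0 → Ω → ℝ} {g : ℤ → Ω → ℝ}
  {R : ℤ → unitInterval → Ω → ℝ}
  {Ω' : Type v} [MeasurableSpace Ω'] {P' : Measure Ω'} [IsProbabilityMeasure P']
  {σ' : ℝ → ℝ} {φ' : ℝ} {ε' : ℤ → Ω' → ℝ} {W' : ℤ → ℝ≥0 → Ω' → ℝ} {g' : ℤ → Ω' → ℝ}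
  {R' : ℤ → unitInterval → Ω' → ℝ}

/-- Both models have `𝔼 log g = 0`, so the mean of the logarithm of the common functional `Ψ` equals
`log G` in each. -/
lemma G_eq_of_identDistrib (hc : Conditions σ φ ε W P) (hc' : Conditions σ' φ' ε' W' P')
    (hs : IsSolution σ φ ε W g R P) (hR : StrictlyStationary (fun i ω t => R i t ω) P)
    (hs' : IsSolution σ' φ' ε' W' g' R' P') (hR' : StrictlyStationary (fun i ω t => R' i t ω) P')
    {i : ℤ} (hid : IdentDistrib (fun ω t => R i t ω) (fun ω t => R' i t ω) P P')
    {t : unitInterval} (ht : 0 < G σ t) : G σ' t = G σ t := by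
  have hq := hs.isQuadraticVariation hc i
  have hq' := hs'.isQuadraticVariation hc' i
  obtain ⟨Ψ, hΨm, hΨ, hΨ'⟩ := exists_functional_of_tendstoInMeasure.{u, v}
    (measurable_dyadicVariation t) (hq.tendstoInMeasure_dyadicVariation t)
  have hΨ' := hΨ' hid (hq'.tendstoInMeasure_dyadicVariation t)
  have hpos : ∀ᵐ ω ∂P, 0 < Ψ (fun s => R i s ω) := by
    filter_upwards [hΨ, hs.g_pos i] with ω h1 h2
    rw [← h1]
    positivity
  have hpos' : ∀ᵐ ω ∂P', 0 < Ψ (fun s => R' i s ω) :=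
    hid.ae_snd (p := fun x => 0 < Ψ x) (measurableSet_lt measurable_const hΨm) hpos
  -- Positivity has to transfer first, because the logarithm is injective only on positive reals.
  have ht' : 0 < G σ' t := by
    obtain ⟨ω, h1, h2⟩ := (hΨ'.and hpos').exists
    rw [← h1] at h2
    exact pos_of_mul_pos_right h2 (sq_nonneg _)
  have e := (hs.log_quadraticVariation hc hR hq ht).2.2
  have e' := (hs'.log_quadraticVariation hc' hR' hq' ht').2.2
  have hl : ∫ ω, Real.log (g i ω ^ 2 * G σ t) ∂P = ∫ ω, Real.log (g' i ω ^ 2 * G σ' t) ∂P' := by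
    rw [integral_congr_ae (g := fun ω => Real.log (Ψ (fun s => R i s ω)))
      (by filter_upwards [hΨ] with ω h; rw [h]),
      integral_congr_ae (μ := P') (g := fun ω => Real.log (Ψ (fun s => R' i s ω)))
      (by filter_upwards [hΨ'] with ω h; rw [h])]
    exact (hid.comp hΨm.log).integral_eq
  rw [e, e'] at hl
  exact (Real.log_injOn_pos ht ht' hl).symm

/-- Once `G` is common, `√(Ψ / G)` recovers the factor from the curve by the same formula in both
models. -/
lemma identDistrib_pair_of_G_eq (hc : Conditions σ φ ε W P) (hc' : Conditions σ' φ' ε' W' P')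
    (hs : IsSolution σ φ ε W g R P) (hs' : IsSolution σ' φ' ε' W' g' R' P')
    {i : ℤ} (hid : IdentDistrib (fun ω t => R i t ω) (fun ω t => R' i t ω) P P')
    {t : unitInterval} (ht : 0 < G σ t) (hG : G σ' t = G σ t) :
    IdentDistrib (fun ω => (g i ω, fun t => R i t ω)) (fun ω => (g' i ω, fun t => R' i t ω))
      P P' := by
  have hq := hs.isQuadraticVariation hc i
  have hq' := hs'.isQuadraticVariation hc' i
  obtain ⟨Ψ, hΨm, hΨ, hΨ'⟩ := exists_functional_of_tendstoInMeasure.{u, v}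
    (measurable_dyadicVariation t) (hq.tendstoInMeasure_dyadicVariation t)
  have hΨ' := hΨ' hid (hq'.tendstoInMeasure_dyadicVariation t)
  let F : (unitInterval → ℝ) → ℝ × (unitInterval → ℝ) := fun x => (Real.sqrt (Ψ x / G σ t), x)
  have mF : Measurable F := (hΨm.div_const _).sqrt.prodMk measurable_id
  have key : ∀ a : ℝ, 0 < a → Real.sqrt (a ^ 2 * G σ t / G σ t) = a := fun a ha => by
    rw [mul_div_cancel_right₀ _ ht.ne', Real.sqrt_sq ha.le]
  have h1 : IdentDistrib (fun ω => F (fun t => R i t ω)) (fun ω => (g i ω, fun t => R i t ω))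
      P P := by
    refine IdentDistrib.of_ae_eq (mF.comp_aemeasurable hid.aemeasurable_fst) ?_
    filter_upwards [hΨ, hs.g_pos i] with ω h1 h2
    simp only [F, ← h1, key _ h2]
  have h2 : IdentDistrib (fun ω => F (fun t => R' i t ω)) (fun ω => (g' i ω, fun t => R' i t ω))
      P' P' := by
    refine IdentDistrib.of_ae_eq (mF.comp_aemeasurable hid.aemeasurable_snd) ?_
    filter_upwards [hΨ', hs'.g_pos i] with ω h1 h2
    rw [hG] at h1
    simp only [F, ← h1, key _ h2]
  exact (h1.symm.trans (hid.comp mF)).trans h2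

end Identifiability

end FunctionalSV

/-! ### Assembly of the three claims. -/

theorem mainTheorem9 {Ω : Type u} [MeasurableSpace Ω] (P : Measure Ω) [IsProbabilityMeasure P]
    (σ : ℝ → ℝ) (φ : ℝ) (ε : ℤ → Ω → ℝ) (W : ℤ → ℝ≥0 → Ω → ℝ)
    (hc : FunctionalSV.Conditions σ φ ε W P) :
    -- existence and uniqueness of the strictly stationary solution
    (∃ (g : ℤ → Ω → ℝ) (R : ℤ → unitInterval → Ω → ℝ),
      FunctionalSV.IsSolution σ φ ε W g R P ∧
      FunctionalSV.StrictlyStationary (fun i ω => Real.log (g i ω)) P ∧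
      FunctionalSV.StrictlyStationary (fun i ω t => R i t ω) P ∧
      ∀ (g' : ℤ → Ω → ℝ) (R' : ℤ → unitInterval → Ω → ℝ), FunctionalSV.IsSolution σ φ ε W g' R' P →
        (FunctionalSV.StrictlyStationary (fun i ω t => R' i t ω) P →
          ∀ᵐ ω ∂P, ∀ i t, R' i t ω = R i t ω) ∧
        (FunctionalSV.StrictlyStationary (fun i ω => Real.log (g' i ω)) P →
          ∀ᵐ ω ∂P, ∀ i, g' i ω = g i ω ∧ ∀ t, R' i t ω = R i t ω)) ∧
    -- the quadratic variation separates `g` from `σ`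
    (∀ (g : ℤ → Ω → ℝ) (R : ℤ → unitInterval → Ω → ℝ), FunctionalSV.IsSolution σ φ ε W g R P →
      FunctionalSV.StrictlyStationary (fun i ω t => R i t ω) P → ∀ i : ℤ,
        FunctionalSV.IsQuadraticVariation (R i)
          (fun t ω => g i ω ^ 2 * FunctionalSV.G σ t) P ∧
        ∀ Q : unitInterval → Ω → ℝ, FunctionalSV.IsQuadraticVariation (R i) Q P →
          ∀ t : unitInterval, 0 < FunctionalSV.G σ t →
            (∀ᵐ ω ∂P, Real.log (Q t ω) = 2 * Real.log (g i ω) + FunctionalSV.H σ t) ∧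
            Integrable (fun ω => Real.log (Q t ω)) P ∧
            ∫ ω, Real.log (Q t ω) ∂P = FunctionalSV.H σ t) ∧
    -- identifiability: the law of one curve determines `σ` and how `g i` is read off the curve
    (∀ (Ω' : Type v) [MeasurableSpace Ω'] (P' : Measure Ω') [IsProbabilityMeasure P']
      (σ' : ℝ → ℝ) (φ' : ℝ) (ε' : ℤ → Ω' → ℝ) (W' : ℤ → ℝ≥0 → Ω' → ℝ)
      (g : ℤ → Ω → ℝ) (R : ℤ → unitInterval → Ω → ℝ) (g' : ℤ → Ω' → ℝ) (R' : ℤ → unitInterval → Ω' → ℝ),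
      FunctionalSV.Conditions σ' φ' ε' W' P' →
      FunctionalSV.IsSolution σ φ ε W g R P →
      FunctionalSV.StrictlyStationary (fun i ω t => R i t ω) P →
      FunctionalSV.IsSolution σ' φ' ε' W' g' R' P' →
      FunctionalSV.StrictlyStationary (fun i ω t => R' i t ω) P' →
      ∀ i : ℤ, IdentDistrib (fun ω t => R i t ω) (fun ω t => R' i t ω) P P' →
        σ =ᵐ[volume.restrict (Set.Icc (0 : ℝ) 1)] σ' ∧
        (0 < FunctionalSV.G σ 1 →
          IdentDistrib (fun ω => (g i ω, fun t => R i t ω))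
            (fun ω => (g' i ω, fun t => R' i t ω)) P P')) := by
  refine ⟨?_, fun g R hs hR i => ⟨hs.isQuadraticVariation hc i, fun Q hQ t ht =>
    hs.log_quadraticVariation hc hR hQ ht⟩, ?_⟩
  · obtain ⟨g, R, hs, hg, hR⟩ := hc.exists_solution
    refine ⟨g, R, hs, hg, hR, fun g' R' hs' => ⟨fun hR' => ?_, fun hg' => ?_⟩⟩
    · rw [ae_all_iff]
      intro i
      by_cases h : ∃ t, 0 < FunctionalSV.G σ t
      · obtain ⟨t, ht⟩ := h
        exact hs.curve_ae_eq hs' hc (hs.ae_eq_of_log_ae_eq hs'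
          ((hs'.log_eq_of_strictlyStationary hc hR' ht i).trans
            (hs.log_eq_of_strictlyStationary hc hR ht i).symm))
      -- Here `g` cannot be recovered from the curves, but all curves vanish.
      · have h0 : ∀ t, FunctionalSV.G σ t = 0 := fun t =>
          le_antisymm (not_lt.1 fun ht => h ⟨t, ht⟩) (FunctionalSV.G_nonneg hc.integrableOn_sq t)
        filter_upwards [hs.curve_ae_eq_zero hc h0 i, hs'.curve_ae_eq_zero hc h0 i] with ω h1 h2 t
        rw [h1, h2]
    · rw [ae_all_iff]
      intro i
      have h := hs.ae_eq_of_log_ae_eq hs'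
        ((hs'.log_eq_of_identDistrib hc (fun i => hg'.identDistrib i 0) i).trans
          (hs.log_eq_of_identDistrib hc (fun i => hg.identDistrib i 0) i).symm)
      filter_upwards [h, hs.curve_ae_eq hs' hc h] with ω h1 h2
      exact ⟨h1, h2⟩
  · intro Ω' _ P' _ σ' φ' ε' W' g R g' R' hc' hs hR hs' hR' i hid
    have hG : ∀ t, FunctionalSV.G σ t = FunctionalSV.G σ' t := by
      intro t
      by_cases h : 0 < FunctionalSV.G σ t
      · exact (FunctionalSV.G_eq_of_identDistrib hc hc' hs hR hs' hR' hid h).symm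
      -- The roles of the two models are exchanged; if neither `G` is positive, both are zero.
      by_cases h' : 0 < FunctionalSV.G σ' t
      · exact FunctionalSV.G_eq_of_identDistrib hc' hc hs' hR' hs hR hid.symm h'
      rw [le_antisymm (not_lt.1 h) (FunctionalSV.G_nonneg hc.integrableOn_sq t),
        le_antisymm (not_lt.1 h') (FunctionalSV.G_nonneg hc'.integrableOn_sq t)]
    exact ⟨FunctionalSV.ae_eq_of_G_eq hc.sigma_measurable hc'.sigma_measurable hc.sigma_nonneg
      hc'.sigma_nonneg hc.integrableOn_sq hc'.integrableOn_sq hG, fun h1 =>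
      FunctionalSV.identDistrib_pair_of_G_eq hc hc' hs hs' hid h1 (hG 1).symm⟩
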